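/- Let $d\in\mathbb N$ and let $X$ be one of the Banach spaces $\ell_p(\mathbb Z;\mathbb C^d)$ $(1\le p\le\infty)$, $c_0(\mathbb Z;\mathbb C^d)$, $c(\mathbb Z;\mathbb C^d)$. Let $(A_n)_{n\in\mathbb Z}$ be complex $d\times d$ matrices with $\sum_n|A_n|<\infty$, let $\mathbf A$ be the bounded operator on $X$ given by $(\mathbf A u)_n=\sum_k A_{n-k}u_k$, and let $A(z)=\sum_n A_nz^n$, $z\in\mathbb T=\{|z|=1\}$, be its symbol. In general, a bounded operator $T$ on $X$ is called the convolution operator with symbol $F$ if $(Tu)_n=\sum_k \hat F_{n-k}u_k$ (unconditionally convergent) for all $u\in X$ and $n\in\mathbb Z$, where $\hat F_n=\frac1{2\pi}\int_0^{2\pi}F(e^{i\theta})e^{-in\theta}\,d\theta$. Fix a Schur triangularization of the symbol: for every $z\in\mathbb T$ an orthonormal basis $\varphi^{(1)}(z),\dots,\varphi^{(d)}(z)$ of $\mathbb C^d$ with $$A(z)\varphi^{(k)}(z)=\lambda_k(z)\varphi^{(k)}(z)+\sum_{l<k}\mu_{kl}(z)\varphi^{(l)}(z),\qquad k=1,\dots,d,$$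 where $\varphi^{(k)}(e^{i\theta})$ is measurable in $\theta$ and $\theta\mapsto\lambda_k(e^{i\theta})$ is continuous on $[0,2\pi)$; thus $\lambda_1(z),\dots,\lambda_d(z)$ are the eigenvalues of $A(z)$. Put $\Delta P_k(z)=\langle\cdot,\varphi^{(k)}(z)\rangle\varphi^{(k)}(z)$ and $A_0(z)=\sum_{k}\lambda_k(z)\Delta P_k(z)$. Let $\Gamma$ be the union of the curves $\Gamma_k=\lambda_k(\mathbb T)$, whose points are counted together with the number $k$ of the curve and the parameter: a point is $\nu=\lambda_k(e^{it_\nu})$ with given $k$ and $t_\nu\in[0,2\pi)$. A point $\nu$ of $\Gamma_k$ precedes a point $\mu$ of $\Gamma_l$ (and $\mu$ follows $\nu$), written $\nu\prec\mu$, if $k<l$, or $k=l$ and $t_\nu<t_\mu$. For a point $\nu$ of $\Gamma_k$ put $$P_\nu(z)=\sum_{l<k}\Delta P_l(z)+\chi_\nu(z)\,\Delta P_k(z),$$ where $\chi_\nu(e^{i\theta})=1$ for $0\le\theta<t_\nu$ and $\chi_\nu(e^{i\theta})=0$ for $t_\nu\le\theta<2\pi$. The value $t_\nu=2\pi$ (the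 end point of $\Gamma_k$) is also allowed for $\nu$ in $P_\nu$ and in (ii). Let $\mathbf A_0$, $\Delta\mathbf P_k$, $\mathbf P_\nu$ be the convolution operators with the symbols $A_0$, $\Delta P_k$, $P_\nu$, whenever these are bounded operators on $X$. Then the following holds. (i) $\sigma(\mathbf A)=\bigcup_{j=1}^d\overline{\lambda_j(\mathbb T)}$. If $\Delta\mathbf P_1,\dots,\Delta\mathbf P_d$ are bounded on $X$, then so is $\mathbf A_0$, and $\sigma(\mathbf A)=\sigma(\mathbf A_0)$. (ii) If $\mathbf P_\nu$ is bounded on $X$, then it is a projection, $\mathbf P_\nu X$ is invariant under $\mathbf A$, the spectrum of the restriction of $\mathbf A$ to $\mathbf P_\nu X$ is the closure of the set of all points of $\Gamma$ preceding $\nu$, and the spectrum of the operator $(I-\mathbf P_\nu)\mathbf A$ on $(I-\mathbf P_\nu)X$ is the closure of the set of all points of $\Gamma$ following $\nu$. For $X=\ell_2(\mathbb Z;\mathbb C^d)$ all the operators $\Delta\mathbf P_k$ and $\mathbf P_\nu$ are bounded, so that (i) and (ii) hold without restriction. -/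

import Mathlib

open Set Filter Topology MeasureTheory
open scoped ENNReal

namespace BlockConv

noncomputable section

/-- The space `ℂ^d` with its Euclidean norm. -/
abbrev Vec (d : ℕ) : Type := EuclideanSpace ℂ (Fin d)

/-- `d × d` complex matrices, regarded as operators on `ℂ^d` (with the operator norm). -/
abbrev Mat (d : ℕ) : Type := Vec d →L[ℂ] Vec d

/-- The Banach space `ℓ_p(ℤ; ℂ^d)`. -/
abbrev SeqLp (d : ℕ) (p : ℝ≥0∞) : Type := lp (fun _ : ℤ => Vec d) p

/-- The sequences in `ℓ_p(ℤ; ℂ^d)` that tend to `0` as `|n| → ∞`. For `p = ∞` this is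
`c_0(ℤ; ℂ^d)` with the supremum norm. -/
def c0 (d : ℕ) (p : ℝ≥0∞) : Submodule ℂ (SeqLp d p) where
  carrier := {u | Tendsto (fun n : ℤ => u n) cofinite (𝓝 0)}
  zero_mem' := by
    simp only [mem_ofPred_eq, lp.coeFn_zero, Pi.zero_apply]
    exact tendsto_const_nhds
  add_mem' := by
    intro u v hu hv
    simpa using Tendsto.add hu hv
  smul_mem' := by
    intro a u hu
    simpa using Tendsto.const_smul hu a

/-- The sequences in `ℓ_p(ℤ; ℂ^d)` that converge as `|n| → ∞`. For `p = ∞` this is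
`c(ℤ; ℂ^d)` with the supremum norm. -/
def c (d : ℕ) (p : ℝ≥0∞) : Submodule ℂ (SeqLp d p) where
  carrier := {u | ∃ a : Vec d, Tendsto (fun n : ℤ => u n) cofinite (𝓝 a)}
  zero_mem' := by
    refine ⟨0, ?_⟩
    simp only [lp.coeFn_zero, Pi.zero_apply]
    exact tendsto_const_nhds
  add_mem' := by
    rintro u v ⟨a, hu⟩ ⟨b, hv⟩
    exact ⟨a + b, by simpa using Tendsto.add hu hv⟩
  smul_mem' := by
    rintro r u ⟨a, hu⟩
    exact ⟨r • a, by simpa using Tendsto.const_smul hu r⟩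

/-- The variant of `c(ℤ; ℂ^d)` in which the limits at `+∞` and at `-∞` may differ. -/
def cTwoSided (d : ℕ) (p : ℝ≥0∞) : Submodule ℂ (SeqLp d p) where
  carrier := {u | ∃ a b : Vec d, Tendsto (fun n : ℤ => u n) atTop (𝓝 a) ∧
    Tendsto (fun n : ℤ => u n) atBot (𝓝 b)}
  zero_mem' := by
    refine ⟨0, 0, ?_, ?_⟩ <;>
    · simp only [lp.coeFn_zero, Pi.zero_apply]
      exact tendsto_const_nhds
  add_mem' := by
    rintro u v ⟨a, b, ha, hb⟩ ⟨a', b', ha', hb'⟩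
    exact ⟨a + a', b + b', by simpa using Tendsto.add ha ha', by simpa using Tendsto.add hb hb'⟩
  smul_mem' := by
    rintro r u ⟨a, b, ha, hb⟩
    exact ⟨r • a, r • b, by simpa using Tendsto.const_smul ha r,
      by simpa using Tendsto.const_smul hb r⟩

/-- The sequence spaces under consideration: `ℓ_p` (this is `X = ⊤`, `1 ≤ p ≤ ∞`), and, for
`p = ∞`, the spaces `c_0` and `c` (for `p < ∞` the last three alternatives again give all of
`ℓ_p`, because a `p`-summable sequence tends to zero). -/
def IsSeqSpace {d : ℕ} {p : ℝ≥0∞} (X : Submodule ℂ (SeqLp d p)) : Prop :=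
  X = ⊤ ∨ X = c0 d p ∨ X = c d p ∨ X = cTwoSided d p

/-- `T` is the bounded convolution operator on `X` with matrix coefficients `a`:
`(T u)_n = ∑_k a_{n-k} u_k` for all `u ∈ X` and `n ∈ ℤ`. -/
def IsConvOp {d : ℕ} {p : ℝ≥0∞} [Fact (1 ≤ p)] {X : Submodule ℂ (SeqLp d p)}
    (T : X →L[ℂ] X) (a : ℤ → Mat d) : Prop :=
  ∀ (u : X) (n : ℤ),
    HasSum (fun k : ℤ => a (n - k) ((u : SeqLp d p) k)) ((T u : SeqLp d p) n)

/-- The symbol `A(z) = ∑_n A_n z^n`, `|z| = 1`. -/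
def symbol {d : ℕ} (A : ℤ → Mat d) (z : Circle) : Mat d :=
  ∑' n : ℤ, ((z : ℂ) ^ n) • A n

/-- The Fourier coefficients `(2π)⁻¹ ∫_0^{2π} F(e^{iθ}) e^{-inθ} dθ` of a matrix function on the
unit circle. -/
def fourierCoeffs {d : ℕ} (F : Circle → Mat d) (n : ℤ) : Mat d :=
  ((2 * Real.pi : ℝ) : ℂ)⁻¹ •
    ∫ θ in (0 : ℝ)..(2 * Real.pi), ((Circle.exp θ : ℂ) ^ (-n)) • F (Circle.exp θ)

/-- A Schur triangularization of a matrix function `a` on the unit circle: orthonormal vectors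
`φ^{(1)}(z), …, φ^{(d)}(z)` of `ℂ^d` in which `a(z)` is upper triangular with diagonal
`λ_1(z), …, λ_d(z)` (so that these are the eigenvalues of `a(z)`, with multiplicity). The numbering
is such that each `λ_k(e^{iθ})` is continuous for `0 ≤ θ < 2π`; the vectors depend measurably
on the angle `θ`. -/
structure SchurData {d : ℕ} (a : Circle → Mat d) where
  lam : Fin d → Circle → ℂ
  phi : Fin d → Circle → Vec d
  mu : Fin d → Fin d → Circle → ℂ
  orthonormal : ∀ z, Orthonormal ℂ (fun k => phi k z)
  triangular : ∀ z k,
    a z (phi k z) = lam k z • phi k z + ∑ l ∈ Finset.Iio k, mu k l z • phi l z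
  continuousOn_lam : ∀ k,
    ContinuousOn (fun θ : ℝ => lam k (Circle.exp θ)) (Ico 0 (2 * Real.pi))
  measurable_phi : ∀ k, Measurable (fun θ : ℝ => phi k (Circle.exp θ))

namespace SchurData

variable {d : ℕ} {a : Circle → Mat d} (s : SchurData a)

/-- `ΔP_k(z) = ⟨·, φ^{(k)}(z)⟩ φ^{(k)}(z)`. -/
def deltaP (k : Fin d) (z : Circle) : Mat d :=
  (innerSL ℂ (s.phi k z)).smulRight (s.phi k z)

/-- The diagonal part `A_0(z) = ∑_l λ_l(z) ΔP_l(z)`. -/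
def diag (z : Circle) : Mat d :=
  ∑ l : Fin d, s.lam l z • s.deltaP l z

/-- For the point `ν` of the curve `Γ_k` with parameter `t`, the orthogonal projections
`P_ν(z) = P_{k-1}(z) + χ ΔP_k(z)` in `ℂ^d`, where `P_{k-1}(z) = ∑_{l<k} ΔP_l(z)` and `χ` is `1` on
the part of `Γ_k` from its beginning up to `ν` (excluded), that is, for `z = e^{iθ}` with
`0 ≤ θ < t`, and `0` elsewhere. -/
def projNu (k : Fin d) (t : ℝ) (z : Circle) : Mat d :=
  ∑ l ∈ Finset.Iio k, s.deltaP l z + (Circle.exp '' Ico 0 t).indicator (s.deltaP k) z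

/-- The points of `Γ` preceding the point `ν` of `Γ_k` with parameter `t`: points
`λ_l(e^{iθ})`, `0 ≤ θ < 2π`, on a curve with a lower number, or on `Γ_k` with `θ < t`. -/
def preceding (k : Fin d) (t : ℝ) : Set ℂ :=
  {w | ∃ (l : Fin d) (θ : ℝ), 0 ≤ θ ∧ θ < 2 * Real.pi ∧ (l < k ∨ (l = k ∧ θ < t)) ∧
    w = s.lam l (Circle.exp θ)}

/-- The points of `Γ` following the point `ν` of `Γ_k` with parameter `t`. -/
def following (k : Fin d) (t : ℝ) : Set ℂ :=
  {w | ∃ (l : Fin d) (θ : ℝ), 0 ≤ θ ∧ θ < 2 * Real.pi ∧ (k < l ∨ (l = k ∧ t < θ)) ∧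
    w = s.lam l (Circle.exp θ)}

end SchurData

/-- The range `P X` of a bounded operator `P` on `X`. -/
abbrev rangeOf {X : Type*} [NormedAddCommGroup X] [NormedSpace ℂ X] (P : X →L[ℂ] X) :
    Submodule ℂ X :=
  LinearMap.range P.toLinearMap

/-- The restriction of `T` to an invariant subspace `W`, as a bounded operator on `W`. -/
def restrictTo {X : Type*} [NormedAddCommGroup X] [NormedSpace ℂ X] (T : X →L[ℂ] X)
    (W : Submodule ℂ X) (h : ∀ x ∈ W, T x ∈ W) : W →L[ℂ] W :=
  (T.comp W.subtypeL).codRestrict W (fun x => h x x.2)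

/-- The spectrum of the restriction of `T` to the invariant subspace `W`. -/
def spectrumOn {X : Type*} [NormedAddCommGroup X] [NormedSpace ℂ X] (T : X →L[ℂ] X)
    (W : Submodule ℂ X) (h : ∀ x ∈ W, T x ∈ W) : Set ℂ :=
  spectrum ℂ (restrictTo T W h)

/-- The subspace `Q X` is invariant under `Q T`. -/
theorem comp_mem_rangeOf {X : Type*} [NormedAddCommGroup X] [NormedSpace ℂ X]
    (Q T : X →L[ℂ] X) : ∀ x ∈ rangeOf Q, (Q * T) x ∈ rangeOf Q :=
  fun x _ => ⟨T x, rfl⟩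

end

end BlockConv

namespace BlockConv

noncomputable section

/-! ### Translations and pointwise maps on `ℓ_p(ℤ; E)` -/

section Translation

variable {E F : Type*} [NormedAddCommGroup E] [NormedAddCommGroup F] {p : ℝ≥0∞}

/-! Everything reduces to one statement about blocks (`spectrumOn_eq`). Let `V` be a convolution
operator whose symbol at `z` is the orthogonal projection onto the Schur vectors with indices in `I
z`. Suppose that `I z` is an interval of indices and that `I` is locally constant from the right in
the angle. Then the compression of `A` to the range of `V` has as its spectrum the closure of all
`λ_l(z)` with `l ∈ I z`. The whole space is the case of all indices, the diagonal blocks are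
singletons, and `P_ν` and `1 - P_ν` give an initial segment and its complement.

The difficulty is that the Schur vectors are only measurable, so the compressed symbol lies outside
the Wiener algebra and its inverse cannot be taken there. The symbol `A(z)` does lie in the Wiener
algebra, so inverses are built from functions of `A(z)` and compressed afterwards. Compression to an
interval of indices is multiplicative on matrices that are triangular in the Schur basis
(`Tri.proj_mul_mul_proj`). The functions used are the moments `(2πi)⁻¹ ∮ (ζ - c)ⁿ (ζ - A)⁻¹ dζ` over
a small circle about `c`. Near each point of the unit circle some radius avoids the spectrum of
`A(z)`; Wiener's lemma then gives the moments, multiplied by a bump function, as matrices over the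
Wiener algebra (`exists_local_moments`).

If `c` has positive distance from the eigenvalues of the block, the moment of order `-1` inverts `c
- A` up to the Riesz projection, whose block vanishes because no block eigenvalue is encircled. The
functions up to which the compression is invertible form an ideal of the Wiener algebra without
common zeros, so it contains `1` (`exists_relative_inverse`).

If `c` is in the closure and `G` is a left inverse of the compression, choose a circle of radius `r
< 1 / (‖G‖ + 1)` around `c` that encloses a block eigenvalue at some point. The compressed moments
satisfy `Y n = -(G * Y (n + 1))` and `‖Y n‖ ≤ C rⁿ`, so `Y 0 = 0`. But the symbol of `Y 0` has a
diagonal entry equal to the bump function on a one-sided neighbourhood of that point, a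
contradiction (`not_mem_closure_of_left_inverse`).

These computations take place among symbols. They transfer to operators because composition
multiplies bounded measurable symbols (`IsConvOp.mul`) and the Fourier coefficients determine both
the operator and, almost everywhere, the symbol. -/

theorem memℓp_comp_equiv {f : ℤ → E} (hf : Memℓp f p) (e : ℤ ≃ ℤ) : Memℓp (fun n => f (e n)) p := by
  obtain rfl | rfl | hp := p.trichotomy
  · rw [memℓp_zero_iff] at hf ⊢
    exact hf.preimage e.injective.injOn
  · rw [memℓp_infty_iff] at hf ⊢
    refine hf.mono ?_
    rintro _ ⟨n, rfl⟩
    exact ⟨e n, rfl⟩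
  · rw [memℓp_gen_iff hp] at hf ⊢
    exact (e.summable_iff (f := fun n => ‖f n‖ ^ p.toReal)).2 hf

theorem lp_norm_comp_equiv [Fact (1 ≤ p)] (f g : lp (fun _ : ℤ => E) p) (e : ℤ ≃ ℤ)
    (h : ∀ n, g n = f (e n)) : ‖g‖ ≤ ‖f‖ := by
  obtain rfl | rfl | hp := p.trichotomy
  · exact absurd (Fact.out : (1 : ℝ≥0∞) ≤ 0) (by simp)
  · exact lp.norm_le_of_forall_le (norm_nonneg _) fun n => by
      rw [h]; exact lp.norm_apply_le_norm (by simp) f (e n)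
  · refine lp.norm_le_of_tsum_le hp (norm_nonneg _) ?_
    rw [lp.norm_rpow_eq_tsum hp f, ← e.tsum_eq (fun n => ‖f n‖ ^ p.toReal)]
    simp [h]

variable [NormedSpace ℂ E] [NormedSpace ℂ F]

variable (E p) in
/-- Translation by `k` on `ℓ_p(ℤ; E)`. -/
def translate [Fact (1 ≤ p)] (k : ℤ) :
    lp (fun _ : ℤ => E) p →L[ℂ] lp (fun _ : ℤ => E) p :=
  LinearMap.mkContinuous
    { toFun := fun u => ⟨fun n => u (n - k), memℓp_comp_equiv (lp.memℓp u) (Equiv.subRight k)⟩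
      map_add' := fun u v => by ext; rfl
      map_smul' := fun c u => by ext; rfl } 1 fun u => by
    rw [one_mul]
    exact lp_norm_comp_equiv u _ (Equiv.subRight k) fun n => rfl

@[simp] theorem translate_apply [Fact (1 ≤ p)] (k : ℤ) (u : lp (fun _ : ℤ => E) p) (n : ℤ) :
    translate E p k u n = u (n - k) := rfl

theorem norm_translate_le [Fact (1 ≤ p)] (k : ℤ) : ‖translate E p k‖ ≤ 1 :=
  LinearMap.mkContinuous_norm_le _ zero_le_one _

theorem translate_single [Fact (1 ≤ p)] (k m : ℤ) (x : E) :
    translate E p k (lp.single p m x) = lp.single p (m + k) x := by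
  refine lp.ext (funext fun n => ?_)
  rw [translate_apply, lp.coeFn_single, lp.coeFn_single]
  by_cases h : n = m + k
  · subst h; simp
  · rw [Pi.single_eq_of_ne h, Pi.single_eq_of_ne]
    intro h'; apply h; omega

variable (p) in
/-- The operator on `ℓ_p(ℤ; E)` that applies a fixed operator in each coordinate. -/
def pointwise [Fact (1 ≤ p)] (T : E →L[ℂ] F) :
    lp (fun _ : ℤ => E) p →L[ℂ] lp (fun _ : ℤ => F) p :=
  LinearMap.mkContinuous
    { toFun := fun u => ⟨fun n => T (u n), ((lp.memℓp u).const_smul (‖T‖ : ℂ)).mono' fun n => by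
        simpa [norm_smul] using T.le_opNorm (u n)⟩
      map_add' := fun u v => by ext n; exact map_add T (u n) (v n)
      map_smul' := fun c u => by ext n; exact map_smul T c (u n) } ‖T‖ fun u => by
    -- The bound is the norm of the sequence `‖T‖ • u`, which dominates `T u` termwise; monotonicity
    -- of the norm then treats all `p` at once.
    have h : (‖T‖ : ℝ) * ‖u‖ = ‖((‖T‖ : ℂ)) • u‖ := by rw [norm_smul]; simp
    rw [h]
    refine lp.norm_mono (zero_lt_one.trans_le (Fact.out : 1 ≤ p)).ne' fun n => ?_
    rw [lp.coeFn_smul, Pi.smul_apply, norm_smul]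
    simpa using T.le_opNorm (u n)

end Translation

/-! ### Contractive representations of `ℤ` and the Wiener algebra -/

/-- A homomorphism from `ℤ` to the unit ball of a normed algebra. -/
structure IntRep (R : Type*) [NormedRing R] where
  toFun : ℤ → R
  map_zero : toFun 0 = 1
  map_add : ∀ m n, toFun (m + n) = toFun m * toFun n
  norm_le : ∀ n, ‖toFun n‖ ≤ 1

variable (E : Type*) [NormedAddCommGroup E] [NormedSpace ℂ E] (p : ℝ≥0∞) in
/-- The translations on `ℓ_p(ℤ; E)`. -/
def translateRep [Fact (1 ≤ p)] :
    IntRep (lp (fun _ : ℤ => E) p →L[ℂ] lp (fun _ : ℤ => E) p) where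
  toFun := translate E p
  map_zero := by ext u n; simp
  map_add m n := by
    ext u k
    simp [sub_sub]
  norm_le := norm_translate_le

/-- The absolutely summable complex sequences, to be equipped with the convolution product. -/
def Wiener : Type := lp (fun _ : ℤ => ℂ) 1

namespace Wiener

instance : NormedAddCommGroup Wiener := inferInstanceAs (NormedAddCommGroup (lp (fun _ : ℤ => ℂ) 1))
instance : NormedSpace ℂ Wiener := inferInstanceAs (NormedSpace ℂ (lp (fun _ : ℤ => ℂ) 1))
instance : CompleteSpace Wiener := inferInstanceAs (CompleteSpace (lp (fun _ : ℤ => ℂ) 1))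

/-- The `n`-th term of a summable sequence. -/
def coeff (n : ℤ) : Wiener →L[ℂ] ℂ := lp.evalCLM ℂ (fun _ : ℤ => ℂ) 1 n

/-- The unit sequences. -/
def basis (n : ℤ) : Wiener := lp.single (E := fun _ : ℤ => ℂ) 1 n (1 : ℂ)

theorem coeff_basis (m n : ℤ) : coeff m (basis n) = if m = n then 1 else 0 := by
  change (lp.single (E := fun _ : ℤ => ℂ) 1 n (1 : ℂ)) m = _
  rw [lp.coeFn_single, Pi.single_apply]

/-- The unit sequences span a dense subspace of `ℓ_1`, so every multilinear identity of the
convolution product can be checked on them. -/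
theorem clm_ext {F : Type*} [AddCommMonoid F] [Module ℂ F] [TopologicalSpace F] [T2Space F]
    {f g : Wiener →L[ℂ] F} (h : ∀ n, f (basis n) = g (basis n)) : f = g := by
  refine lp.ext_continuousLinearMap (E := fun _ : ℤ => ℂ) (p := 1) (by simp) fun n => ?_
  ext
  exact h n

theorem summable_norm_coeff (a : Wiener) : Summable fun n => ‖coeff n a‖ := by
  have := (lp.memℓp (p := 1) a).summable (by simp)
  simp only [ENNReal.toReal_one, Real.rpow_one] at this
  exact this

theorem tsum_norm_coeff (a : Wiener) : ∑' n, ‖coeff n a‖ = ‖a‖ := by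
  have := lp.norm_rpow_eq_tsum (E := fun _ : ℤ => ℂ) (p := 1) (by simp) a
  simp only [ENNReal.toReal_one, Real.rpow_one] at this
  exact this.symm

/-- The element of the Wiener algebra with given coefficients. -/
def ofCoeff (f : ℤ → ℂ) (hf : Summable fun n => ‖f n‖) : Wiener :=
  ⟨f, memℓp_gen (by simpa using hf)⟩

section Lift

variable {R : Type*} [NormedRing R] [NormedAlgebra ℂ R] (s : IntRep R)

theorem summable_coeff_smul (a : Wiener) : Summable fun n => ‖coeff n a • s.toFun n‖ := by
  refine (summable_norm_coeff a).of_nonneg_of_le (fun _ => norm_nonneg _) fun n => ?_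
  rw [norm_smul]
  exact mul_le_of_le_one_right (norm_nonneg _) (s.norm_le n)

variable [CompleteSpace R]

/-- The continuous linear map `a ↦ ∑ a_n s^n`. -/
def liftL : Wiener →L[ℂ] R :=
  LinearMap.mkContinuous
    { toFun := fun a => ∑' n, coeff n a • s.toFun n
      map_add' := fun a b => by
        simp only [map_add, add_smul]
        exact (summable_coeff_smul s a).of_norm.tsum_add (summable_coeff_smul s b).of_norm
      map_smul' := fun c a => by
        simp only [map_smul, smul_assoc, RingHom.id_apply]
        exact (summable_coeff_smul s a).of_norm.tsum_const_smul c } 1 fun a => by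
    rw [one_mul, ← tsum_norm_coeff]
    refine (norm_tsum_le_tsum_norm (summable_coeff_smul s a)).trans
      ((summable_coeff_smul s a).tsum_le_tsum (fun n => ?_) (summable_norm_coeff a))
    rw [norm_smul]
    exact mul_le_of_le_one_right (norm_nonneg _) (s.norm_le n)

theorem hasSum_liftL (a : Wiener) : HasSum (fun n => coeff n a • s.toFun n) (liftL s a) :=
  (summable_coeff_smul s a).of_norm.hasSum

theorem liftL_basis (n : ℤ) : liftL s (basis n) = s.toFun n := by
  refine (hasSum_liftL s (basis n)).unique ?_
  convert hasSum_ite_eq n (s.toFun n) using 2 with m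
  rw [coeff_basis]
  split_ifs with h
  · rw [h, one_smul]
  · rw [zero_smul]

theorem norm_liftL_le : ‖liftL s‖ ≤ 1 := LinearMap.mkContinuous_norm_le _ zero_le_one _

end Lift

/-- The translations on the Wiener algebra. -/
def shiftRep : IntRep (Wiener →L[ℂ] Wiener) := translateRep ℂ 1

/-- Convolution. -/
def mulL : Wiener →L[ℂ] Wiener →L[ℂ] Wiener := liftL shiftRep

theorem mulL_basis (m n : ℤ) : mulL (basis m) (basis n) = basis (m + n) := by
  rw [mulL, liftL_basis, add_comm]
  exact translate_single (E := ℂ) (p := 1) m n 1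

theorem mulL_comm (a b : Wiener) : mulL a b = mulL b a := by
  have : mulL = mulL.flip := by
    refine clm_ext fun m => clm_ext fun n => ?_
    rw [ContinuousLinearMap.flip_apply, mulL_basis, mulL_basis, add_comm]
  conv_lhs => rw [this]
  rfl

theorem mulL_assoc (a b c : Wiener) : mulL (mulL a b) c = mulL a (mulL b c) := by
  -- Both bracketings are written as continuous trilinear maps, so that density of the unit
  -- sequences applies in each variable.
  have : (ContinuousLinearMap.compL ℂ Wiener Wiener (Wiener →L[ℂ] Wiener) mulL).comp mulL =
      ((ContinuousLinearMap.compL ℂ Wiener (Wiener →L[ℂ] Wiener) (Wiener →L[ℂ] Wiener)).flip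
        mulL).comp ((ContinuousLinearMap.compL ℂ Wiener Wiener Wiener).comp mulL) := by
    refine clm_ext fun k => clm_ext fun m => clm_ext fun n => ?_
    simp [mulL_basis, add_assoc]
  exact congr($this a b c)

instance : One Wiener := ⟨basis 0⟩
instance : Mul Wiener := ⟨fun a b => mulL a b⟩

theorem one_def : (1 : Wiener) = basis 0 := rfl

theorem one_mulL (a : Wiener) : mulL (basis 0) a = a := by
  have : mulL (basis 0) = ContinuousLinearMap.id ℂ Wiener :=
    clm_ext fun n => by rw [mulL_basis, zero_add]; rfl
  rw [this]; rfl

instance : NormedCommRing Wiener where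
  toNorm := inferInstance
  toMetricSpace := inferInstance
  __ := (inferInstance : AddCommGroup Wiener)
  mul a b := a * b
  one := 1
  left_distrib a b c := map_add (mulL a) b c
  right_distrib a b c := by
    change mulL (a + b) c = mulL a c + mulL b c
    rw [map_add]; rfl
  zero_mul a := by change mulL 0 a = 0; rw [map_zero]; rfl
  mul_zero a := map_zero (mulL a)
  mul_assoc := mulL_assoc
  one_mul := one_mulL
  mul_one a := (mulL_comm a _).trans (one_mulL a)
  mul_comm := mulL_comm
  dist_eq := NormedAddCommGroup.dist_eq
  norm_mul_le a b := by
    refine (mulL.le_opNorm₂ a b).trans ?_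
    have : ‖mulL‖ ≤ 1 := norm_liftL_le _
    gcongr
    exact mul_le_of_le_one_left (norm_nonneg a) this

instance : NormedAlgebra ℂ Wiener :=
  { Algebra.ofModule
      (fun c a b => by change mulL (c • a) b = c • mulL a b; rw [map_smul]; rfl)
      (fun c a b => map_smul (mulL a) c b) with
    norm_smul_le := fun c a => (norm_smul_le c a) }

theorem basis_mul (m n : ℤ) : basis m * basis n = basis (m + n) := mulL_basis m n

theorem norm_basis (n : ℤ) : ‖basis n‖ = 1 := by
  have := lp.norm_single (E := fun _ : ℤ => ℂ) (p := 1) (by simp) n (1 : ℂ)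
  rw [norm_one] at this
  exact this

section Lift

variable {R : Type*} [NormedRing R] [NormedAlgebra ℂ R] [CompleteSpace R] (s : IntRep R)

/-- The algebra homomorphism `a ↦ ∑ a_n s^n`. -/
def lift : Wiener →ₐ[ℂ] R :=
  AlgHom.ofLinearMap (liftL s).toLinearMap
    (by change liftL s (basis 0) = 1; rw [liftL_basis, s.map_zero])
    (by
      have : (ContinuousLinearMap.compL ℂ Wiener Wiener R (liftL s)).comp mulL =
          ((ContinuousLinearMap.compL ℂ Wiener R R).flip (liftL s)).comp
            ((ContinuousLinearMap.mul ℂ R).comp (liftL s)) := by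
        refine clm_ext fun m => clm_ext fun n => ?_
        simp [mulL_basis, liftL_basis, s.map_add]
      intro a b
      exact congr($this a b))

theorem continuous_lift : Continuous (lift s) := (liftL s).continuous

end Lift

/-- The powers of a point of the unit circle. -/
def circleRep (z : Circle) : IntRep ℂ where
  toFun n := (z : ℂ) ^ n
  map_zero := zpow_zero _
  map_add m n := zpow_add₀ (Circle.coe_ne_zero z) m n
  norm_le n := by rw [norm_zpow, Circle.norm_coe, one_zpow]

/-- The value at `z` of the absolutely convergent Fourier series. -/
def eval (z : Circle) : Wiener →ₐ[ℂ] ℂ := lift (circleRep z)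

theorem hasSum_eval (z : Circle) (a : Wiener) :
    HasSum (fun n => coeff n a * (z : ℂ) ^ n) (eval z a) :=
  hasSum_liftL (circleRep z) a

theorem continuous_eval (a : Wiener) : Continuous fun z => eval z a := by
  have h : (fun z => eval z a) = fun z : Circle => ∑' n, coeff n a * (z : ℂ) ^ n :=
    funext fun z => (hasSum_eval z a).tsum_eq.symm
  rw [h]
  refine continuous_tsum (fun n => ?_) (summable_norm_coeff a) fun n z => by
    rw [norm_mul, norm_zpow, Circle.norm_coe, one_zpow, mul_one]
  exact continuous_const.mul
    ((by fun_prop : Continuous fun z : Circle => (z : ℂ)).zpow₀ n fun z => Or.inl (Circle.coe_ne_zero z))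

/-- Every character of the Wiener algebra is the evaluation at a point of the unit circle. -/
theorem exists_eval_eq (χ : WeakDual.characterSpace ℂ Wiener) :
    ∃ z : Circle, ∀ a, χ a = eval z a := by
  have hle : ∀ n, ‖χ (basis n)‖ ≤ 1 := fun n => by
    have := spectrum.norm_le_norm_mul_of_mem (AlgHom.apply_mem_spectrum χ (basis n))
    rwa [one_def, norm_basis, norm_basis, one_mul] at this
  have hadd : ∀ m n, χ (basis (m + n)) = χ (basis m) * χ (basis n) := fun m n => by
    rw [← basis_mul, map_mul]
  have hone : χ (basis 0) = 1 := map_one χ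
  have hmul : χ (basis 1) * χ (basis (-1)) = 1 := by rw [← hadd]; exact hone
  -- A character is contractive on `basis 1` and on its inverse `basis (-1)`, which forces modulus
  -- one.
  have hnorm : ‖χ (basis 1)‖ = 1 := by
    refine le_antisymm (hle 1) ?_
    have h1 : ‖χ (basis 1)‖ * ‖χ (basis (-1))‖ = 1 := by rw [← norm_mul, hmul, norm_one]
    calc (1 : ℝ) = ‖χ (basis 1)‖ * ‖χ (basis (-1))‖ := h1.symm
      _ ≤ ‖χ (basis 1)‖ := mul_le_of_le_one_right (norm_nonneg _) (hle _)
  have hne : χ (basis 1) ≠ 0 := fun h => by rw [h, norm_zero] at hnorm; exact zero_ne_one hnorm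
  let z : Circle := ⟨χ (basis 1), by simpa [Submonoid.unitSphere] using hnorm⟩
  have hpow : ∀ n, χ (basis n) = (z : ℂ) ^ n := fun n => by
    change _ = χ (basis 1) ^ n
    induction n with
    | zero => simpa using hone
    | succ n ih => rw [hadd, ih, zpow_add_one₀ hne]
    | pred n ih =>
      rw [sub_eq_add_neg, hadd, ih, ← sub_eq_add_neg, zpow_sub_one₀ hne, eq_inv_of_mul_eq_one_right hmul]
  refine ⟨z, fun a => ?_⟩
  have : (WeakDual.CharacterSpace.toCLM χ) = liftL (circleRep z) := clm_ext fun n => by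
    rw [liftL_basis]; exact hpow n
  exact congr($this a)

/-- An ideal of the Wiener algebra without common zeros contains `1`. -/
theorem one_mem_of_forall_exists (J : Ideal Wiener) (h : ∀ z : Circle, ∃ a ∈ J, eval z a ≠ 0) :
    (1 : Wiener) ∈ J := by
  rw [← Ideal.eq_top_iff_one]
  by_contra hJ
  obtain ⟨M, hM, hJM⟩ := J.exists_le_maximal hJ
  -- By Gelfand–Mazur a maximal ideal is the kernel of a character, here an evaluation, so the
  -- proper ideal would have a common zero.
  obtain ⟨z, hz⟩ := exists_eval_eq M.toCharacterSpace
  obtain ⟨a, ha, hne⟩ := h z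
  exact hne ((hz a).symm.trans (M.toCharacterSpace_apply_eq_zero_of_mem (hJM ha)))

/-- Wiener's lemma. -/
theorem isUnit_of_eval_ne_zero (a : Wiener) (h : ∀ z : Circle, eval z a ≠ 0) : IsUnit a := by
  have := one_mem_of_forall_exists (Ideal.span {a})
    fun z => ⟨a, Ideal.mem_span_singleton_self a, h z⟩
  exact isUnit_of_dvd_one (Ideal.mem_span_singleton.1 this)

end Wiener

/-! ### Matrices over the Wiener algebra -/

/-- Matrices over the Wiener algebra. -/
abbrev MatWiener (d : ℕ) : Type := Matrix (Fin d) (Fin d) Wiener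

namespace MatWiener

variable {d : ℕ}

instance : NormedRing (MatWiener d) := Matrix.linftyOpNormedRing
instance : NormedAlgebra ℂ (MatWiener d) := Matrix.linftyOpNormedAlgebra
instance : @CompleteSpace (MatWiener d)
    (NormedRing.toMetricSpace.toPseudoMetricSpace.toUniformSpace) :=
  inferInstanceAs (CompleteSpace (Fin d → Fin d → Wiener))

/-- Scalar matrices as operators on `ℂ^d`. -/
def ofMatrix : Matrix (Fin d) (Fin d) ℂ ≃ₐ[ℂ] Mat d :=
  (Matrix.toEuclideanCLM (n := Fin d) (𝕜 := ℂ)).toAlgEquiv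

theorem ofMatrix_apply (M : Matrix (Fin d) (Fin d) ℂ) (x : Vec d) (i : Fin d) :
    ofMatrix M x i = ∑ j, M i j * x j := rfl

/-- The `n`-th Fourier coefficient of a matrix over the Wiener algebra. -/
def coeffMat (n : ℤ) (M : MatWiener d) : Mat d := ofMatrix (M.map (Wiener.coeff n))

/-- The value of a matrix over the Wiener algebra at a point of the circle. -/
def eval (z : Circle) : MatWiener d →ₐ[ℂ] Mat d :=
  ofMatrix.toAlgHom.comp (Wiener.eval z).mapMatrix

theorem eval_apply (z : Circle) (M : MatWiener d) : eval z M = ofMatrix (M.map (Wiener.eval z)) :=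
  rfl

theorem continuous_entry (i j : Fin d) : Continuous fun M : MatWiener d => M i j :=
  (continuous_apply j).comp (continuous_apply (A := fun _ : Fin d => Fin d → Wiener) i)

theorem continuous_eval (z : Circle) : Continuous (eval (d := d) z) := by
  have h1 : Continuous (ofMatrix (d := d)) :=
    LinearMap.continuous_of_finiteDimensional ofMatrix.toLinearMap
  refine h1.comp (continuous_matrix fun i j => ?_)
  exact (Wiener.continuous_lift (Wiener.circleRep z)).comp (continuous_entry i j)

theorem continuous_eval_left (M : MatWiener d) : Continuous fun z => eval z M := by
  have h1 : Continuous (ofMatrix (d := d)) :=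
    LinearMap.continuous_of_finiteDimensional ofMatrix.toLinearMap
  exact h1.comp (continuous_matrix fun i j => Wiener.continuous_eval (M i j))

/-- The determinant reduces the matrix form of Wiener's lemma to the scalar one, the Wiener algebra
being commutative. -/
theorem isUnit_of_eval (M : MatWiener d) (h : ∀ z, IsUnit (eval z M)) : IsUnit M := by
  rw [Matrix.isUnit_iff_isUnit_det]
  refine Wiener.isUnit_of_eval_ne_zero _ fun z => ?_
  rw [AlgHom.map_det, ← isUnit_iff_ne_zero, ← Matrix.isUnit_iff_isUnit_det]
  have := (h z).map (ofMatrix (d := d)).symm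
  rwa [eval_apply, AlgEquiv.symm_apply_apply] at this

/-- The matrix over the Wiener algebra with a given summable family of coefficients. -/
def ofCoeffMat (A : ℤ → Mat d) (hA : Summable fun n => ‖A n‖) : MatWiener d := fun i j =>
  Wiener.ofCoeff (fun n => ofMatrix.symm (A n) i j) <| by
    let T : Mat d →ₗ[ℂ] ℂ := (Matrix.entryLinearMap ℂ ℂ i j).comp ofMatrix.symm.toLinearMap
    let T' : Mat d →L[ℂ] ℂ := ⟨T, LinearMap.continuous_of_finiteDimensional T⟩
    exact (hA.mul_left ‖T'‖).of_nonneg_of_le (fun _ => norm_nonneg _) fun n => T'.le_opNorm (A n)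

@[simp] theorem coeffMat_ofCoeffMat (A : ℤ → Mat d) (hA : Summable fun n => ‖A n‖) (n : ℤ) :
    coeffMat n (ofCoeffMat A hA) = A n :=
  ofMatrix.apply_symm_apply (A n)

section Lift

variable {R : Type*} [NormedRing R] [NormedAlgebra ℂ R] [CompleteSpace R] (s : IntRep R)
  (π : Mat d →ₐ[ℂ] R) (hc : ∀ n T, Commute (s.toFun n) (π T))

include hc in
theorem commute_lift (a : Wiener) (T : Mat d) : Commute (Wiener.lift s a) (π T) := by
  have h := Wiener.hasSum_liftL s a
  refine (h.mul_right (π T)).unique ?_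
  have h' := h.mul_left (π T)
  simp only [mul_smul_comm] at h'
  simp only [smul_mul_assoc, (hc _ T).eq]
  exact h'

/-- The algebra homomorphism from the matrices over the Wiener algebra determined by a contractive
representation of `ℤ` and a representation of the scalar matrices which commute. -/
def lift : MatWiener d →ₐ[ℂ] R :=
  -- Matrices over the Wiener algebra are its tensor product with the scalar matrices, so
  -- multiplicativity comes from the universal property.
  (Algebra.TensorProduct.lift (Wiener.lift s) (π.comp ofMatrix.toAlgHom)
    fun a M => commute_lift s π hc a (ofMatrix M)).comp
      (matrixEquivTensor (Fin d) ℂ Wiener).toAlgHom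

theorem lift_apply (M : MatWiener d) :
    lift s π hc M = ∑ i, ∑ j, Wiener.lift s (M i j) * π (ofMatrix (Matrix.single i j 1)) := by
  simp only [lift, AlgHom.comp_apply, AlgEquiv.coe_toAlgHom, matrixEquivTensor_apply, map_sum,
    Fintype.sum_prod_type]
  exact Finset.sum_congr rfl fun i _ => Finset.sum_congr rfl fun j _ =>
    Algebra.TensorProduct.lift_tmul _ _ _ _ _

theorem continuous_lift : Continuous (lift s π hc) := by
  have : (lift s π hc : MatWiener d → R) =
      fun M => ∑ i, ∑ j, Wiener.lift s (M i j) * π (ofMatrix (Matrix.single i j 1)) :=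
    funext (lift_apply s π hc)
  rw [this]
  refine continuous_finsetSum _ fun i _ => continuous_finsetSum _ fun j _ => ?_
  exact ((Wiener.continuous_lift s).comp (continuous_entry i j)).mul continuous_const

theorem hasSum_lift (M : MatWiener d) :
    HasSum (fun n => s.toFun n * π (coeffMat n M)) (lift s π hc M) := by
  rw [lift_apply]
  have : (fun n => s.toFun n * π (coeffMat n M)) = fun n => ∑ i, ∑ j,
      (Wiener.coeff n (M i j) • s.toFun n) * π (ofMatrix (Matrix.single i j 1)) := by
    funext n
    rw [coeffMat, Matrix.matrix_eq_sum_single (M.map (Wiener.coeff n))]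
    simp only [map_sum, Finset.mul_sum]
    refine Finset.sum_congr rfl fun i _ => Finset.sum_congr rfl fun j _ => ?_
    have h : Matrix.single i j (M.map (Wiener.coeff n) i j) =
        Wiener.coeff n (M i j) • Matrix.single i j (1 : ℂ) := by
      rw [Matrix.smul_single, smul_eq_mul, mul_one, Matrix.map_apply]
    rw [h, map_smul, map_smul, mul_smul_comm, smul_mul_assoc]
  rw [this]
  exact hasSum_sum fun i _ => hasSum_sum fun j _ => (Wiener.hasSum_liftL s (M i j)).mul_right _

end Lift

theorem hasSum_eval (z : Circle) (M : MatWiener d) :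
    HasSum (fun n => ((z : ℂ) ^ n) • coeffMat n M) (eval z M) := by
  have h1 : Continuous (ofMatrix (d := d)) :=
    LinearMap.continuous_of_finiteDimensional ofMatrix.toLinearMap
  have h2 : HasSum (fun n => ((z : ℂ) ^ n) • M.map (Wiener.coeff n)) (M.map (Wiener.eval z)) := by
    refine Pi.hasSum.2 fun i => Pi.hasSum.2 fun j => ?_
    simpa [mul_comm] using Wiener.hasSum_eval z (M i j)
  have := h2.map (ofMatrix (d := d)) h1
  simp only [Function.comp_def, map_smul] at this
  exact this

theorem symbol_eq_eval (A : ℤ → Mat d) (hA : Summable fun n => ‖A n‖) (z : Circle) :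
    symbol A z = eval z (ofCoeffMat A hA) := by
  refine HasSum.tsum_eq ?_
  simpa using hasSum_eval z (ofCoeffMat A hA)

/-- Elements of the Wiener algebra as scalar matrices. -/
def scalar : Wiener →ₐ[ℂ] MatWiener d := Matrix.scalarAlgHom (Fin d) ℂ

theorem eval_scalar (z : Circle) (b : Wiener) :
    eval z (scalar (d := d) b) = Wiener.eval z b • 1 := by
  have h : (scalar (d := d) b).map (Wiener.eval z) = Wiener.eval z b • (1 : Matrix (Fin d) (Fin d) ℂ) := by
    ext i j
    change Wiener.eval z (Matrix.diagonal (fun _ => b) i j) = _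
    rw [Matrix.smul_apply, Matrix.one_apply, Matrix.diagonal_apply]
    split_ifs <;> simp
  rw [eval_apply, h, map_smul, map_one]

end MatWiener

/-! ### Translation invariant sequence spaces -/

/-- The properties of the spaces `ℓ_p`, `c_0` and `c` used below. -/
class Admissible {d : ℕ} {p : ℝ≥0∞} [Fact (1 ≤ p)] (X : Submodule ℂ (SeqLp d p)) : Prop where
  isClosed : IsClosed (X : Set (SeqLp d p))
  translate_mem : ∀ k, ∀ u ∈ X, translate (Vec d) p k u ∈ X
  pointwise_mem : ∀ T : Mat d, ∀ u ∈ X, pointwise p T u ∈ X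
  single_mem : ∀ (n : ℤ) (x : Vec d), lp.single p n x ∈ X
  eq_top : p ≠ ∞ → X = ⊤

section Admissible

variable {d : ℕ} {p : ℝ≥0∞}

theorem lp_tendsto_zero [Fact (1 ≤ p)] (hp : p ≠ ∞) (u : SeqLp d p) :
    Tendsto (fun n : ℤ => u n) cofinite (𝓝 0) := by
  have hp' : 0 < p.toReal :=
    ENNReal.toReal_pos (zero_lt_one.trans_le (Fact.out : 1 ≤ p)).ne' hp
  have h := ((lp.memℓp u).summable hp').tendsto_cofinite_zero
  have h2 : Tendsto (fun x : ℝ => x ^ (p.toReal)⁻¹) (𝓝 0) (𝓝 0) := by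
    have := Real.continuousAt_rpow_const 0 (p.toReal)⁻¹ (Or.inr (inv_nonneg.2 hp'.le))
    simpa [ContinuousAt, Real.zero_rpow (inv_pos.2 hp').ne'] using this
  rw [tendsto_zero_iff_norm_tendsto_zero]
  refine (h2.comp h).congr fun n => ?_
  exact Real.rpow_rpow_inv (norm_nonneg _) hp'.ne'

theorem isClosed_setOf_tendsto [Fact (1 ≤ p)] (l : Filter ℤ) [l.NeBot] (a : Vec d) :
    IsClosed {u : SeqLp d p | Tendsto (fun n => u n) l (𝓝 a)} := by
  refine isClosed_of_closure_subset fun u hu => Metric.tendsto_nhds.2 fun ε hε => ?_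
  obtain ⟨v, hv, huv⟩ := Metric.mem_closure_iff.1 hu (ε / 2) (half_pos hε)
  filter_upwards [Metric.tendsto_nhds.1 hv (ε / 2) (half_pos hε)] with n hn
  have h1 : dist (u n) (v n) ≤ dist u v := by
    rw [dist_eq_norm, dist_eq_norm]
    exact lp.norm_apply_le_norm (zero_lt_one.trans_le (Fact.out : 1 ≤ p)).ne' (u - v) n
  linarith [dist_triangle (u n) (v n) a]

theorem isClosed_setOf_exists_tendsto [Fact (1 ≤ p)] (l : Filter ℤ) [l.NeBot] :
    IsClosed {u : SeqLp d p | ∃ a, Tendsto (fun n => u n) l (𝓝 a)} := by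
  refine isClosed_of_closure_subset fun u hu => ?_
  suffices h : Cauchy (map (fun n => u n) l) from cauchy_map_iff_exists_tendsto.1 h
  refine Metric.cauchy_iff.2 ⟨inferInstance, fun ε hε => ?_⟩
  obtain ⟨v, ⟨a, hv⟩, huv⟩ := Metric.mem_closure_iff.1 hu (ε / 4) (by positivity)
  refine ⟨(fun n => u n) '' {n | dist (v n) a < ε / 4},
    image_mem_map (Metric.tendsto_nhds.1 hv (ε / 4) (by positivity)), ?_⟩
  have h1 : ∀ n, dist (u n) (v n) ≤ dist u v := fun n => by
    rw [dist_eq_norm, dist_eq_norm]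
    exact lp.norm_apply_le_norm (zero_lt_one.trans_le (Fact.out : 1 ≤ p)).ne' (u - v) n
  rintro _ ⟨m, hm, rfl⟩ _ ⟨n, hn, rfl⟩
  have hm' : dist (v m) a < ε / 4 := hm
  have hn' : dist (v n) a < ε / 4 := hn
  have h2 := dist_triangle4 (u m) (v m) (v n) (u n)
  have h3 := dist_triangle_right (v m) (v n) a
  have h4 := h1 n
  rw [dist_comm] at h4
  change dist (u m) (u n) < ε
  linarith [h1 m]

theorem tendsto_single_zero (n : ℤ) (x : Vec d) :
    Tendsto (fun m : ℤ => (lp.single (E := fun _ : ℤ => Vec d) p n x) m) cofinite (𝓝 0) := by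
  refine tendsto_const_nhds.congr' ?_
  filter_upwards [(Set.finite_singleton n).compl_mem_cofinite] with m hm
  exact (lp.single_apply_ne (E := fun _ : ℤ => Vec d) p n x hm).symm

theorem admissible_top [Fact (1 ≤ p)] : Admissible (⊤ : Submodule ℂ (SeqLp d p)) where
  isClosed := isClosed_univ
  translate_mem _ _ _ := trivial
  pointwise_mem _ _ _ := trivial
  single_mem _ _ := trivial
  eq_top _ := rfl

theorem admissible_c0 [Fact (1 ≤ p)] : Admissible (c0 d p) where
  isClosed := isClosed_setOf_tendsto cofinite 0
  translate_mem k u hu :=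
    (show Tendsto (fun n : ℤ => u n) cofinite (𝓝 0) from hu).comp (sub_left_injective (b := k)).tendsto_cofinite
  pointwise_mem T _ hu := by
    have := (T.continuous.tendsto 0).comp hu
    rw [map_zero] at this
    exact this
  single_mem := tendsto_single_zero
  eq_top hp := eq_top_iff.2 fun u _ => lp_tendsto_zero hp u

theorem admissible_c [Fact (1 ≤ p)] : Admissible (c d p) where
  isClosed := isClosed_setOf_exists_tendsto cofinite
  translate_mem k _ := fun ⟨a, hu⟩ =>
    ⟨a, hu.comp (sub_left_injective (b := k)).tendsto_cofinite⟩
  pointwise_mem T _ := fun ⟨a, hu⟩ => ⟨T a, (T.continuous.tendsto a).comp hu⟩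
  single_mem n x := ⟨0, tendsto_single_zero n x⟩
  eq_top hp := eq_top_iff.2 fun u _ => ⟨0, lp_tendsto_zero hp u⟩

theorem admissible_cTwoSided [Fact (1 ≤ p)] : Admissible (cTwoSided d p) where
  isClosed := by
    have : (cTwoSided d p : Set (SeqLp d p)) =
        {u : SeqLp d p | ∃ a, Tendsto (fun n => u n) atTop (𝓝 a)} ∩
          {u : SeqLp d p | ∃ a, Tendsto (fun n => u n) atBot (𝓝 a)} := by
      ext u
      exact ⟨fun ⟨a, b, ha, hb⟩ => ⟨⟨a, ha⟩, b, hb⟩, fun ⟨⟨a, ha⟩, b, hb⟩ => ⟨a, b, ha, hb⟩⟩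
    rw [this]
    exact (isClosed_setOf_exists_tendsto atTop).inter (isClosed_setOf_exists_tendsto atBot)
  translate_mem k _ := fun ⟨a, b, ha, hb⟩ =>
    ⟨a, b, ha.comp (tendsto_atTop_add_const_right _ (-k) tendsto_id),
      hb.comp (tendsto_atBot_add_const_right _ (-k) tendsto_id)⟩
  pointwise_mem T _ := fun ⟨a, b, ha, hb⟩ =>
    ⟨T a, T b, (T.continuous.tendsto a).comp ha, (T.continuous.tendsto b).comp hb⟩
  single_mem n x := by
    have := tendsto_single_zero (p := p) n x
    rw [Int.cofinite_eq] at this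
    exact ⟨0, 0, this.mono_left le_sup_right, this.mono_left le_sup_left⟩
  eq_top hp := eq_top_iff.2 fun u _ => by
    have := lp_tendsto_zero hp u
    rw [Int.cofinite_eq] at this
    exact ⟨0, 0, this.mono_left le_sup_right, this.mono_left le_sup_left⟩

theorem IsSeqSpace.admissible [Fact (1 ≤ p)] {X : Submodule ℂ (SeqLp d p)} (hX : IsSeqSpace X) :
    Admissible X := by
  rcases hX with rfl | rfl | rfl | rfl
  exacts [admissible_top, admissible_c0, admissible_c, admissible_cTwoSided]

end Admissible

/-! ### The action of the Wiener algebra on sequence spaces -/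

section Act

variable {d : ℕ} {p : ℝ≥0∞} [Fact (1 ≤ p)] (X : Submodule ℂ (SeqLp d p))

/-- The `n`-th coordinate of an element of `X`. -/
def coord (n : ℤ) : X →L[ℂ] Vec d := (lp.evalCLM ℂ (fun _ : ℤ => Vec d) p n).comp X.subtypeL

theorem coord_apply (n : ℤ) (u : X) : coord X n u = (u : SeqLp d p) n := rfl

variable [hX : Admissible X]

instance : CompleteSpace X := hX.isClosed.completeSpace_coe

/-- The translations on `X`. -/
def shiftRep : IntRep (X →L[ℂ] X) where
  toFun k := restrictTo (translate (Vec d) p k) X (hX.translate_mem k)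
  map_zero := by
    refine ContinuousLinearMap.ext fun u => Subtype.ext (lp.ext (funext fun n => ?_))
    exact congrArg (fun m => (u : SeqLp d p) m) (sub_zero n)
  map_add j k := by
    refine ContinuousLinearMap.ext fun u => Subtype.ext (lp.ext (funext fun n => ?_))
    exact congrArg (fun m => (u : SeqLp d p) m) (sub_sub n j k).symm
  norm_le k := ContinuousLinearMap.opNorm_le_bound _ zero_le_one fun u =>
    (translate (Vec d) p k).le_of_opNorm_le (norm_translate_le k) u

/-- The coordinatewise action of matrices on `X`. -/
def pointwiseHom : Mat d →ₐ[ℂ] (X →L[ℂ] X) :=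
  AlgHom.ofLinearMap
    { toFun := fun T => restrictTo (pointwise p T) X (hX.pointwise_mem T)
      map_add' := fun _ _ =>
        ContinuousLinearMap.ext fun _ => Subtype.ext (lp.ext (funext fun _ => rfl))
      map_smul' := fun _ _ =>
        ContinuousLinearMap.ext fun _ => Subtype.ext (lp.ext (funext fun _ => rfl)) }
    (ContinuousLinearMap.ext fun _ => Subtype.ext (lp.ext (funext fun _ => rfl)))
    fun _ _ => ContinuousLinearMap.ext fun _ => Subtype.ext (lp.ext (funext fun _ => rfl))

theorem commute_shiftRep_pointwiseHom (k : ℤ) (T : Mat d) :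
    Commute ((shiftRep X).toFun k) (pointwiseHom X T) :=
  ContinuousLinearMap.ext fun _ => Subtype.ext (lp.ext (funext fun _ => rfl))

/-- The action of the matrices over the Wiener algebra on `X` by convolution. -/
def act : MatWiener d →ₐ[ℂ] (X →L[ℂ] X) :=
  MatWiener.lift (d := d) (R := X →L[ℂ] X) (shiftRep X) (pointwiseHom X) (commute_shiftRep_pointwiseHom X)

theorem continuous_act : Continuous (act X) := MatWiener.continuous_lift (d := d) (R := X →L[ℂ] X) _ _ _

theorem isConvOp_act (M : MatWiener d) :
    IsConvOp (act X M) (fun n => MatWiener.coeffMat n M) := by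
  intro u n
  have h0 := MatWiener.hasSum_lift (d := d) (R := X →L[ℂ] X) (shiftRep X) (pointwiseHom X)
  have h := h0 (commute_shiftRep_pointwiseHom X) M
  let L : (X →L[ℂ] X) →L[ℂ] Vec d := (coord X n).comp (ContinuousLinearMap.apply ℂ X u)
  have h3 := (Equiv.subLeft n).hasSum_iff.2 (h.map L L.continuous)
  have h4 : (fun k => MatWiener.coeffMat (n - k) M ((u : SeqLp d p) k)) =
      (L ∘ fun k => (shiftRep X).toFun k * pointwiseHom X (MatWiener.coeffMat k M)) ∘
        Equiv.subLeft n := by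
    funext k
    change _ = MatWiener.coeffMat (n - k) M ((u : SeqLp d p) (n - (n - k)))
    rw [sub_sub_cancel]
  rw [h4]
  exact h3

end Act

/-! ### Fourier coefficients of bounded measurable functions -/

instance fact_two_pi_pos : Fact (0 < 2 * Real.pi) := ⟨Real.two_pi_pos⟩

/-- Bounded functions on the circle which depend measurably on the angle. -/
structure BddMeas (f : Circle → ℂ) : Prop where
  measurable : Measurable fun θ : ℝ => f (Circle.exp θ)
  bounded : ∃ C : ℝ, ∀ z, ‖f z‖ ≤ C

/-- A function on the circle as a function of the angle modulo `2π`. -/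
def pullback (f : Circle → ℂ) (t : AddCircle (2 * Real.pi)) : ℂ := f (AddCircle.toCircle t)

theorem pullback_coe (f : Circle → ℂ) (θ : ℝ) : pullback f θ = f (Circle.exp θ) := by
  rw [pullback, AddCircle.toCircle_apply_mk, div_self Real.two_pi_pos.ne', one_mul]

/-- The Fourier coefficients of a scalar function on the circle. -/
def scoeff (f : Circle → ℂ) (n : ℤ) : ℂ := fourierCoeff (pullback f) n

theorem fourier_coe_eq (n : ℤ) (θ : ℝ) :
    (fourier n (θ : AddCircle (2 * Real.pi)) : ℂ) = (Circle.exp θ : ℂ) ^ n := by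
  rw [fourier_apply, AddCircle.toCircle_zsmul, AddCircle.toCircle_apply_mk,
    div_self Real.two_pi_pos.ne', one_mul, Circle.coe_zpow]

theorem scoeff_eq_intervalIntegral (f : Circle → ℂ) (n : ℤ) :
    scoeff f n = ((2 * Real.pi : ℝ) : ℂ)⁻¹ *
      ∫ θ in (0 : ℝ)..(2 * Real.pi), ((Circle.exp θ : ℂ) ^ (-n)) * f (Circle.exp θ) := by
  rw [scoeff, fourierCoeff_eq_intervalIntegral _ n 0, zero_add]
  simp only [fourier_coe_eq, pullback_coe, smul_eq_mul]
  rw [Complex.real_smul, one_div, Complex.ofReal_inv]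

namespace BddMeas

variable {f g : Circle → ℂ}

theorem mul (hf : BddMeas f) (hg : BddMeas g) : BddMeas fun z => f z * g z := by
  obtain ⟨C, hC⟩ := hf.bounded
  obtain ⟨D, hD⟩ := hg.bounded
  refine ⟨hf.measurable.mul hg.measurable, C * D, fun z => ?_⟩
  rw [norm_mul]
  exact mul_le_mul (hC z) (hD z) (norm_nonneg _) ((norm_nonneg _).trans (hC z))

theorem add (hf : BddMeas f) (hg : BddMeas g) : BddMeas fun z => f z + g z := by
  obtain ⟨C, hC⟩ := hf.bounded
  obtain ⟨D, hD⟩ := hg.bounded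
  exact ⟨hf.measurable.add hg.measurable, C + D, fun z => norm_add_le_of_le (hC z) (hD z)⟩

theorem const (c : ℂ) : BddMeas fun _ => c := ⟨measurable_const, ‖c‖, fun _ => le_rfl⟩

theorem sum {ι : Type*} (s : Finset ι) {F : ι → Circle → ℂ} (h : ∀ i ∈ s, BddMeas (F i)) :
    BddMeas fun z => ∑ i ∈ s, F i z := by
  classical
  induction s using Finset.induction_on with
  | empty => simpa using const 0
  | insert a s ha ih =>
    simp only [Finset.sum_insert ha]
    exact (h a (Finset.mem_insert_self a s)).add
      (ih fun i hi => h i (Finset.mem_insert_of_mem hi))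

theorem conj (hf : BddMeas f) : BddMeas fun z => (starRingEnd ℂ) (f z) := by
  obtain ⟨C, hC⟩ := hf.bounded
  exact ⟨Complex.continuous_conj.measurable.comp hf.measurable, C, fun z => by simpa using hC z⟩

theorem of_continuous (hf : Continuous f) : BddMeas f := by
  refine ⟨(hf.comp Circle.exp.continuous).measurable, ?_⟩
  obtain ⟨C, hC⟩ := isCompact_univ.exists_bound_of_continuousOn hf.continuousOn
  exact ⟨C, fun z => hC z trivial⟩

theorem measurable_pullback (hf : BddMeas f) : Measurable (pullback f) := by
  have h : pullback f = (fun θ : ℝ => f (Circle.exp θ)) ∘ Subtype.val ∘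
      AddCircle.measurableEquivIoc (2 * Real.pi) 0 := by
    funext t
    have : ((AddCircle.measurableEquivIoc (2 * Real.pi) 0 t : ℝ) : AddCircle (2 * Real.pi)) = t :=
      AddCircle.coe_equivIoc (p := 2 * Real.pi) (a := 0)
    exact (congrArg (pullback f) this.symm).trans (pullback_coe f _)
  rw [h]
  exact hf.measurable.comp (measurable_subtype_coe.comp (MeasurableEquiv.measurable _))

theorem memLp (hf : BddMeas f) (p : ℝ≥0∞) : MemLp (pullback f) p AddCircle.haarAddCircle := by
  obtain ⟨C, hC⟩ := hf.bounded
  exact MemLp.of_bound hf.measurable_pullback.aestronglyMeasurable C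
    (Eventually.of_forall fun t => hC _)

theorem continuous_zpow (n : ℤ) : Continuous fun z : Circle => (z : ℂ) ^ n :=
  (by fun_prop : Continuous fun z : Circle => (z : ℂ)).zpow₀ n
    fun z => Or.inl (Circle.coe_ne_zero z)

theorem scoeff_toLp (hf : BddMeas f) (n : ℤ) :
    inner ℂ (fourierBasis n) ((hf.memLp 2).toLp (pullback f)) = scoeff f n := by
  rw [← HilbertBasis.repr_apply_apply, fourierBasis_repr, scoeff,
    fourierCoeff_congr_ae (MemLp.coeFn_toLp _)]

theorem inner_toLp (hf : BddMeas f) (hg : BddMeas g) :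
    inner ℂ ((hf.memLp 2).toLp (pullback f)) ((hg.memLp 2).toLp (pullback g)) =
      ∫ t, pullback g t * (starRingEnd ℂ) (pullback f t) ∂AddCircle.haarAddCircle := by
  rw [L2.inner_def]
  refine integral_congr_ae ?_
  filter_upwards [(hf.memLp 2).coeFn_toLp, (hg.memLp 2).coeFn_toLp] with t h1 h2
  rw [h1, h2]
  rfl

/-- This turns the coefficients `f̂_{n-k}` of a convolution row into conjugated coefficients of the
single function `f̄ zⁿ`, so that Parseval's formula can be applied. -/
theorem scoeff_conj_mul (n k : ℤ) :
    scoeff (fun z => (starRingEnd ℂ) (f z) * (z : ℂ) ^ n) k =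
      (starRingEnd ℂ) (scoeff f (n - k)) := by
  rw [scoeff, scoeff, fourierCoeff, fourierCoeff, ← integral_conj]
  refine integral_congr_ae (Eventually.of_forall fun t => ?_)
  simp only [pullback, fourier_apply, AddCircle.toCircle_zsmul, smul_eq_mul, map_mul,
    Circle.coe_zpow, map_zpow₀, ← Circle.coe_inv_eq_conj, Circle.coe_inv]
  have h := Circle.coe_ne_zero (AddCircle.toCircle t)
  rw [inv_zpow', neg_neg, sub_eq_add_neg, zpow_add₀ h]
  ring

/-- Parseval's formula: the Fourier coefficients of a product. -/
theorem hasSum_scoeff_mul (hf : BddMeas f) (hg : BddMeas g) (n : ℤ) :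
    HasSum (fun k => scoeff f (n - k) * scoeff g k) (scoeff (fun z => f z * g z) n) := by
  -- The `n`-th coefficient of `f g` is the inner product of `f̄ zⁿ` with `g`.
  have hx := hf.conj.mul (of_continuous (continuous_zpow n))
  have h := fourierBasis.hasSum_inner_mul_inner ((hx.memLp 2).toLp _) ((hg.memLp 2).toLp _)
  have h1 : ∀ k, inner ℂ ((hx.memLp 2).toLp _) (fourierBasis k) = scoeff f (n - k) := fun k => by
    rw [← inner_conj_symm, scoeff_toLp hx, scoeff_conj_mul, Complex.conj_conj]
  simp only [h1, scoeff_toLp hg, inner_toLp hx hg] at h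
  convert! h using 1
  rw [scoeff, fourierCoeff]
  refine integral_congr_ae (Eventually.of_forall fun t => ?_)
  simp only [pullback, fourier_apply, AddCircle.toCircle_zsmul, smul_eq_mul, map_mul,
    Circle.coe_zpow, map_zpow₀, ← Circle.coe_inv_eq_conj, Circle.coe_inv, Complex.conj_conj]
  rw [inv_zpow', mul_comm (g _), mul_comm (f _)]
  ring

/-- Completeness of the Fourier basis in `L²`; the null set is then transported from the circle to
the interval of angles. -/
theorem ae_eq_zero (hf : BddMeas f) (h : ∀ n, scoeff f n = 0) :
    ∀ᵐ θ : ℝ ∂(volume.restrict (Ioc 0 (2 * Real.pi))), f (Circle.exp θ) = 0 := by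
  have h0 : (hf.memLp 2).toLp (pullback f) = 0 := by
    apply fourierBasis.repr.injective
    ext n
    rw [HilbertBasis.repr_apply_apply, scoeff_toLp hf, h, map_zero]
    rfl
  have h1 : pullback f =ᵐ[AddCircle.haarAddCircle] 0 := by
    refine (hf.memLp 2).coeFn_toLp.symm.trans ?_
    rw [h0]
    exact Lp.coeFn_zero _ _ _
  have h2 : pullback f =ᵐ[volume] 0 := by
    rw [AddCircle.volume_eq_smul_haarAddCircle]
    exact Measure.ae_smul_measure h1 _
  have h3 := (AddCircle.measurePreserving_mk (2 * Real.pi) 0).quasiMeasurePreserving.ae h2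
  rw [zero_add] at h3
  filter_upwards [h3] with θ hθ
  exact (pullback_coe f θ).symm.trans hθ

/-- The multiplication by a bounded function as a convolution operator on `ℓ_2`. -/
theorem exists_clm (hf : BddMeas f) :
    ∃ T : lp (fun _ : ℤ => ℂ) 2 →L[ℂ] lp (fun _ : ℤ => ℂ) 2,
      ∀ u n, HasSum (fun k => scoeff f (n - k) * u k) (T u n) := by
  let b := fourierBasis (T := 2 * Real.pi)
  -- Multiplication by `f` on `L²` is bounded by Hölder's inequality with exponents `∞` and `2`; the
  -- convolution operator is its conjugate under the Fourier isometry.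
  let M : Lp ℂ 2 (AddCircle.haarAddCircle (T := 2 * Real.pi)) →L[ℂ] Lp ℂ 2 AddCircle.haarAddCircle :=
    (ContinuousLinearMap.mul ℂ ℂ).holderL AddCircle.haarAddCircle ∞ 2 2
      ((hf.memLp ∞).toLp (pullback f))
  refine ⟨(b.repr.toContinuousLinearEquiv : _ →L[ℂ] _).comp
    (M.comp (b.repr.symm.toContinuousLinearEquiv : _ →L[ℂ] _)), fun u n => ?_⟩
  obtain ⟨v, rfl⟩ := b.repr.surjective u
  have hx := hf.conj.mul (of_continuous (continuous_zpow n))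
  have h := b.hasSum_inner_mul_inner ((hx.memLp 2).toLp _) v
  have h1 : ∀ k, inner ℂ ((hx.memLp 2).toLp _) (b k) = scoeff f (n - k) := fun k => by
    rw [← inner_conj_symm, scoeff_toLp hx, scoeff_conj_mul, Complex.conj_conj]
  simp only [h1, ← HilbertBasis.repr_apply_apply] at h
  convert! h using 1
  change b.repr (M (b.repr.symm (b.repr v))) n = _
  rw [LinearIsometryEquiv.symm_apply_apply, fourierBasis_repr, fourierCoeff, L2.inner_def]
  refine integral_congr_ae ?_
  filter_upwards [(hx.memLp 2).coeFn_toLp, (hf.memLp ∞).coeFn_toLp,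
    (ContinuousLinearMap.mul ℂ ℂ).coeFn_holder ((hf.memLp ∞).toLp (pullback f)) v (r := 2)]
    with t ht1 ht2 ht3
  have ht4 : M v t = pullback f t * v t := by rw [← ht2]; exact ht3
  rw [ht1, ht4]
  simp only [pullback, fourier_apply, AddCircle.toCircle_zsmul, smul_eq_mul, map_mul,
    Circle.coe_zpow, RCLike.inner_apply]
  simp only [map_zpow₀, ← Circle.coe_inv_eq_conj, Circle.coe_inv, Complex.conj_conj]
  rw [inv_zpow', ]
  ring

end BddMeas

/-- Absolute summability of the coefficients permits termwise integration. -/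
theorem scoeff_eval (a : Wiener) (n : ℤ) : scoeff (fun z => Wiener.eval z a) n = Wiener.coeff n a := by
  have hs := Wiener.summable_norm_coeff a
  let F : ℤ → AddCircle (2 * Real.pi) → ℂ := fun k t =>
    fourier (-n) t • (Wiener.coeff k a * fourier k t)
  have hF : ∀ k t, ‖F k t‖ = ‖Wiener.coeff k a‖ := fun k t => by
    simp only [F, fourier_apply, norm_smul, norm_mul, Circle.norm_coe, one_mul, mul_one]
  have hcont : ∀ k, Continuous (F k) := fun k =>
    (map_continuous (fourier (-n))).smul (continuous_const.mul (map_continuous (fourier k)))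
  have h := hasSum_integral_of_summable_integral_norm (F := F)
    (μ := AddCircle.haarAddCircle (T := 2 * Real.pi))
    (fun k => (hcont k).integrable_of_hasCompactSupport (HasCompactSupport.of_compactSpace _))
    (by simpa [hF] using hs)
  have h1 : ∀ k, ∫ t, F k t ∂AddCircle.haarAddCircle =
      if k = n then Wiener.coeff n a else 0 := fun k => by
    have := fourierCoeff.const_mul (fourier k) (Wiener.coeff k a) n (T := 2 * Real.pi)
    rw [fourierCoeff_fourier, Pi.single_apply] at this
    refine this.trans ?_
    by_cases hk : k = n
    · subst hk; simp
    · rw [if_neg hk, if_neg (Ne.symm hk), mul_zero]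
  have h2 : ∀ t, ∑' k, F k t = fourier (-n) t • pullback (fun z => Wiener.eval z a) t := fun t => by
    refine HasSum.tsum_eq ?_
    refine ((Wiener.hasSum_eval (AddCircle.toCircle t) a).const_smul (fourier (-n) t : ℂ)).congr_fun ?_
    intro k
    simp only [F, fourier_apply, AddCircle.toCircle_zsmul, Circle.coe_zpow]
  simp only [h1, h2] at h
  exact h.unique (by convert hasSum_ite_eq n (Wiener.coeff n a))

/-! ### Smooth functions belong to the Wiener algebra -/

/-- Integration by parts; the boundary terms cancel by periodicity. -/
theorem integral_zpow_mul_deriv {g g' : ℝ → ℂ} (hg : ∀ x, HasDerivAt g (g' x) x)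
    (hg' : Continuous g') (hper : g (2 * Real.pi) = g 0) (n : ℤ) :
    ∫ θ in (0 : ℝ)..(2 * Real.pi), ((Circle.exp θ : ℂ) ^ (-n)) * g' θ =
      (n * Complex.I) * ∫ θ in (0 : ℝ)..(2 * Real.pi), ((Circle.exp θ : ℂ) ^ (-n)) * g θ := by
  have he : ∀ θ : ℝ, (Circle.exp θ : ℂ) ^ (-n) = Complex.exp (-(n * Complex.I) * θ) := fun θ => by
    rw [Circle.coe_exp, ← Complex.exp_int_mul]
    congr 1
    push_cast
    ring
  have hd : ∀ θ : ℝ, HasDerivAt (fun θ : ℝ => (Circle.exp θ : ℂ) ^ (-n))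
      (-(n * Complex.I) * (Circle.exp θ : ℂ) ^ (-n)) θ := fun θ => by
    simp only [he]
    have h1 : HasDerivAt (fun x : ℝ => -(n * Complex.I) * (x : ℂ)) (-(n * Complex.I)) θ := by
      simpa using (Complex.ofRealCLM.hasDerivAt (x := θ)).const_mul (-(n * Complex.I))
    rw [mul_comm (-(n * Complex.I)) (Complex.exp _)]
    exact h1.cexp
  have hc : Continuous fun θ : ℝ => (Circle.exp θ : ℂ) ^ (-n) :=
    (BddMeas.continuous_zpow (-n)).comp Circle.exp.continuous
  have hgc : Continuous g := continuous_iff_continuousAt.2 fun x => (hg x).continuousAt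
  have h := intervalIntegral.integral_mul_deriv_eq_deriv_mul (a := 0) (b := 2 * Real.pi)
    (fun x _ => hd x) (fun x _ => hg x)
    ((continuous_const.mul hc).intervalIntegrable _ _) (hg'.intervalIntegrable _ _)
  rw [h, hper]
  have h2 : (Circle.exp (2 * Real.pi) : ℂ) = Circle.exp 0 := by simp
  rw [h2, sub_self, zero_sub, ← intervalIntegral.integral_neg, ← intervalIntegral.integral_const_mul]
  congr 1
  funext θ
  ring

/-- Two integrations by parts give coefficients of order `n⁻²`. They are summable, and the Fourier
series then converges to `f` at every point. -/
theorem exists_wiener_of_contDiff {f : Circle → ℂ} (hc : Continuous f)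
    (hf : ContDiff ℝ 2 fun θ : ℝ => f (Circle.exp θ)) : ∃ a : Wiener, ∀ z, Wiener.eval z a = f z := by
  set g : ℝ → ℂ := fun θ => f (Circle.exp θ) with hg
  have hper : Function.Periodic g (2 * Real.pi) := fun θ => by
    simp only [hg, Circle.periodic_exp θ]
  have hg1 : ContDiff ℝ 1 (deriv g) := (contDiff_succ_iff_deriv (n := 1)).1 hf |>.2.2
  have hg2 : Continuous (deriv (deriv g)) := hg1.continuous_deriv le_rfl
  have hd0 : ∀ x, HasDerivAt g (deriv g x) x :=
    fun x => (hf.differentiable (by norm_num) x).hasDerivAt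
  have hd1 : ∀ x, HasDerivAt (deriv g) (deriv (deriv g) x) x :=
    fun x => (hg1.differentiable (by norm_num) x).hasDerivAt
  have hper1 : deriv g (2 * Real.pi) = deriv g 0 := by
    have : deriv (fun x => g (x + 2 * Real.pi)) 0 = deriv g 0 := by
      rw [show (fun x => g (x + 2 * Real.pi)) = g from funext hper]
    rwa [deriv_comp_add_const, zero_add] at this
  obtain ⟨C, hC⟩ := isCompact_Icc.exists_bound_of_continuousOn
    (hg2.continuousOn (s := Icc 0 (2 * Real.pi)))
  have hbound : ∀ n : ℤ, n ≠ 0 → ‖scoeff f n‖ ≤ C * (1 / (n : ℝ) ^ 2) := fun n hn => by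
    have h1 := integral_zpow_mul_deriv hd1 hg2 hper1 n
    rw [integral_zpow_mul_deriv hd0 hg1.continuous (by simpa using hper 0) n] at h1
    have h2 : ‖∫ θ in (0 : ℝ)..(2 * Real.pi), ((Circle.exp θ : ℂ) ^ (-n)) * deriv (deriv g) θ‖ ≤
        C * |2 * Real.pi - 0| := by
      refine intervalIntegral.norm_integral_le_of_norm_le_const fun θ hθ => ?_
      rw [uIoc_of_le Real.two_pi_pos.le] at hθ
      rw [norm_mul, norm_zpow, Circle.norm_coe, one_zpow, one_mul]
      exact hC θ (Ioc_subset_Icc_self hθ)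
    rw [h1, norm_mul, norm_mul, norm_mul, Complex.norm_I, Complex.norm_intCast, sub_zero,
      abs_of_pos Real.two_pi_pos] at h2
    have hn' : (0 : ℝ) < |(n : ℝ)| := abs_pos.2 (Int.cast_ne_zero.2 hn)
    rw [scoeff_eq_intervalIntegral, norm_mul, norm_inv, Complex.norm_real, Real.norm_of_nonneg Real.two_pi_pos.le,
      ← sq_abs, mul_one_div, le_div_iff₀ (by positivity), inv_mul_eq_div, div_mul_eq_mul_div,
      div_le_iff₀ Real.two_pi_pos]
    rw [norm_mul, Complex.norm_I, Complex.norm_intCast] at h2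
    simp only [mul_one] at h2
    linarith [h2, show ‖∫ θ in (0 : ℝ)..(2 * Real.pi), ((Circle.exp θ : ℂ) ^ (-n)) *
      f (Circle.exp θ)‖ * |(n : ℝ)| ^ 2 = |(n : ℝ)| * (|(n : ℝ)| *
      ‖∫ θ in (0 : ℝ)..(2 * Real.pi), ((Circle.exp θ : ℂ) ^ (-n)) * g θ‖) by ring]
  have hsum : Summable (scoeff f) := by
    refine Summable.of_norm_bounded_eventually
      ((Real.summable_one_div_int_pow.2 one_lt_two).mul_left C) ?_
    filter_upwards [(Set.finite_singleton (0 : ℤ)).compl_mem_cofinite] with n hn using hbound n hn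
  let F : C(AddCircle (2 * Real.pi), ℂ) := ⟨pullback f, hc.comp AddCircle.continuous_toCircle⟩
  refine ⟨Wiener.ofCoeff (scoeff f) hsum.norm, fun z => ?_⟩
  have hz : AddCircle.toCircle (T := 2 * Real.pi) ((Complex.arg z : ℝ) : AddCircle (2 * Real.pi)) = z := by
    rw [AddCircle.toCircle_apply_mk, div_self Real.two_pi_pos.ne', one_mul, Circle.exp_arg]
  have h := has_pointwise_sum_fourier_series_of_summable (f := F) hsum (Complex.arg z : ℝ)
  refine (Wiener.hasSum_eval z _).unique ?_
  have hFz : F ((Complex.arg z : ℝ) : AddCircle (2 * Real.pi)) = f z := by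
    change f (AddCircle.toCircle _) = f z
    rw [hz]
  rw [hFz] at h
  convert! h using 2 with n
  rw [fourier_apply, AddCircle.toCircle_zsmul, hz, Circle.coe_zpow]
  rfl

/-- A smooth cut-off function near a point of the circle. -/
theorem exists_wiener_cutoff (w : Circle) {c₁ c₂ : ℝ} (h : c₁ < c₂) :
    ∃ a : Wiener, ∀ z : Circle, ∃ r : ℝ, Wiener.eval z a = r ∧ 0 ≤ r ∧ r ≤ 1 ∧
      (((z : ℂ) * (starRingEnd ℂ) w).re ≤ c₁ → r = 0) ∧
      (c₂ ≤ ((z : ℂ) * (starRingEnd ℂ) w).re → r = 1) := by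
  let ρ : Circle → ℝ := fun z =>
    Real.smoothTransition ((((z : ℂ) * (starRingEnd ℂ) w).re - c₁) / (c₂ - c₁))
  have hc : Continuous ρ := by
    refine Real.smoothTransition.continuous.comp ?_
    refine Continuous.div_const (Continuous.sub (Complex.continuous_re.comp ?_) continuous_const) _
    fun_prop
  have hs : ContDiff ℝ 2 fun θ : ℝ => ρ (Circle.exp θ) := by
    have h1 : ContDiff ℝ 2 fun θ : ℝ => (θ : ℂ) * Complex.I :=
      Complex.ofRealCLM.contDiff.mul contDiff_const
    have h2 : ContDiff ℝ 2 fun θ : ℝ => (Circle.exp θ : ℂ) * (starRingEnd ℂ) w := by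
      simp only [Circle.coe_exp]
      exact h1.cexp.mul contDiff_const
    exact (Real.smoothTransition.contDiff (n := 2)).comp
      (((Complex.reCLM.contDiff.comp h2).sub contDiff_const).div_const _)
  obtain ⟨a, ha⟩ := exists_wiener_of_contDiff (f := fun z => (ρ z : ℂ))
    (Complex.continuous_ofReal.comp hc) (Complex.ofRealCLM.contDiff.comp hs)
  refine ⟨a, fun z => ⟨ρ z, ha z, Real.smoothTransition.nonneg _, Real.smoothTransition.le_one _,
    fun hz => ?_, fun hz => ?_⟩⟩
  · exact Real.smoothTransition.zero_of_nonpos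
      (div_nonpos_of_nonpos_of_nonneg (by linarith) (by linarith))
  · exact Real.smoothTransition.one_of_one_le
      ((one_le_div (by linarith)).2 (by linarith))

/-- Two nested cut-offs: `b'` serves to deform a symbol away from `w`, and `b`, which lives where
`b' = 1`, localizes the result to where nothing was deformed. -/
theorem exists_wiener_bump (w : Circle) {U : Set Circle} (hU : U ∈ 𝓝 w) :
    ∃ b b' : Wiener, Wiener.eval w b ≠ 0 ∧ (∀ z, Wiener.eval z b ≠ 0 → Wiener.eval z b' = 1) ∧
      (∀ z, ‖Wiener.eval z b'‖ ≤ 1) ∧ ∀ z, z ∉ U → Wiener.eval z b' = 0 := by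
  obtain ⟨r, hr, hrU⟩ := Metric.mem_nhds_iff.1 hU
  -- Thresholds for this real part are thresholds for the distance to `w`: `1 - r ^ 2 / 2`
  -- corresponds to distance `r`, and `1 - r ^ 2 / 4` to `r / √2`.
  have hre : ∀ z : Circle, ((z : ℂ) * (starRingEnd ℂ) w).re = 1 - dist z w ^ 2 / 2 := fun z => by
    have h1 := Complex.normSq_sub (z : ℂ) w
    rw [Circle.normSq_coe, Circle.normSq_coe, Complex.normSq_eq_norm_sq, ← dist_eq_norm] at h1
    have h2 : dist z w = dist (z : ℂ) w := rfl
    rw [h2]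
    linarith
  obtain ⟨b', hb'⟩ := exists_wiener_cutoff w (c₁ := 1 - r ^ 2 / 2) (c₂ := 1 - r ^ 2 / 4)
    (by nlinarith)
  obtain ⟨b, hb⟩ := exists_wiener_cutoff w (c₁ := 1 - r ^ 2 / 4) (c₂ := 1) (by nlinarith)
  refine ⟨b, b', ?_, fun z hz => ?_, fun z => ?_, fun z hz => ?_⟩
  · obtain ⟨s, hs, -, -, -, h1⟩ := hb w
    rw [hs, h1 (by rw [hre]; simp)]
    simp
  · obtain ⟨s, hs, -, -, h0, -⟩ := hb z
    obtain ⟨s', hs', -, -, -, h1⟩ := hb' z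
    rw [hs', h1, Complex.ofReal_one]
    by_contra hlt
    exact hz (by rw [hs, h0 (not_le.1 hlt).le, Complex.ofReal_zero])
  · obtain ⟨s', hs', h0, h1, -, -⟩ := hb' z
    rw [hs', Complex.norm_real, Real.norm_of_nonneg h0]
    exact h1
  · obtain ⟨s', hs', -, -, h0, -⟩ := hb' z
    rw [hs', h0, Complex.ofReal_zero]
    have : r ≤ dist z w := not_lt.1 fun hlt => hz (hrU hlt)
    rw [hre]
    nlinarith

/-! ### Matrix entries and Fourier coefficients of matrix functions -/

section Entries

variable {d : ℕ}

/-- The matrix entries of an operator on `ℂ^d`. -/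
def entry (i j : Fin d) : Mat d →L[ℂ] ℂ :=
  (EuclideanSpace.proj i : Vec d →L[ℂ] ℂ).comp
    (ContinuousLinearMap.apply ℂ (Vec d) (EuclideanSpace.single j (1 : ℂ)))

theorem entry_apply (i j : Fin d) (S : Mat d) : entry i j S = S (EuclideanSpace.single j 1) i := rfl

theorem vec_eq_sum (x : Vec d) : x = ∑ j, x j • EuclideanSpace.single j (1 : ℂ) := by
  ext i
  simp [Pi.single_apply]

theorem apply_eq_sum_entry (S : Mat d) (x : Vec d) (i : Fin d) :
    S x i = ∑ j, entry i j S * x j := by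
  conv_lhs => rw [vec_eq_sum x]
  simp [entry_apply, mul_comm]

theorem mat_ext {S T : Mat d} (h : ∀ i j, entry i j S = entry i j T) : S = T := by
  ext x i
  rw [apply_eq_sum_entry, apply_eq_sum_entry]
  simp only [h]

theorem entry_mul (S T : Mat d) (i j : Fin d) :
    entry i j (S * T) = ∑ k, entry i k S * entry k j T := by
  rw [entry_apply, mul_apply_eq_comp, apply_eq_sum_entry]
  rfl

theorem entry_ofMatrix (M : Matrix (Fin d) (Fin d) ℂ) (i j : Fin d) :
    entry i j (MatWiener.ofMatrix M) = M i j := by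
  rw [entry_apply, MatWiener.ofMatrix_apply]
  simp

theorem mat_eq_sum (S : Mat d) :
    S = ∑ i, ∑ j, entry i j S • MatWiener.ofMatrix (Matrix.single i j (1 : ℂ)) := by
  refine mat_ext fun i j => ?_
  simp only [map_sum, map_smul, entry_ofMatrix, Matrix.single_apply, smul_eq_mul, mul_ite, mul_one,
    mul_zero]
  rw [Finset.sum_eq_single i, Finset.sum_eq_single j] <;> simp +contextual

theorem norm_le_sum_entry : ∃ C : ℝ, ∀ S : Mat d, ‖S‖ ≤ C * ∑ i, ∑ j, ‖entry i j S‖ := by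
  refine ⟨∑ i : Fin d, ∑ j : Fin d, ‖MatWiener.ofMatrix (Matrix.single i j (1 : ℂ))‖, fun S => ?_⟩
  conv_lhs => rw [mat_eq_sum S]
  rw [Finset.mul_sum]
  refine (norm_sum_le _ _).trans (Finset.sum_le_sum fun i _ => ?_)
  rw [Finset.mul_sum]
  refine (norm_sum_le _ _).trans (Finset.sum_le_sum fun j _ => ?_)
  rw [norm_smul, mul_comm]
  refine mul_le_mul_of_nonneg_right ?_ (norm_nonneg _)
  exact (Finset.single_le_sum (f := fun j => ‖MatWiener.ofMatrix (Matrix.single i j (1 : ℂ))‖)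
    (fun _ _ => norm_nonneg _) (Finset.mem_univ j)).trans
    (Finset.single_le_sum (f := fun i => ∑ j, ‖MatWiener.ofMatrix (Matrix.single i j (1 : ℂ))‖)
    (fun _ _ => Finset.sum_nonneg fun _ _ => norm_nonneg _) (Finset.mem_univ i))

/-- Bounded measurable matrix functions on the circle. -/
def BddMeasMat (F : Circle → Mat d) : Prop := ∀ i j, BddMeas fun z => entry i j (F z)

namespace BddMeasMat

variable {F G : Circle → Mat d}

theorem mul (hF : BddMeasMat F) (hG : BddMeasMat G) : BddMeasMat fun z => F z * G z := by
  intro i j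
  simp only [entry_mul]
  exact BddMeas.sum _ fun k _ => (hF i k).mul (hG k j)

theorem add (hF : BddMeasMat F) (hG : BddMeasMat G) : BddMeasMat fun z => F z + G z := by
  intro i j
  simp only [map_add]
  exact (hF i j).add (hG i j)

theorem of_continuous (hF : Continuous F) : BddMeasMat F := fun i j =>
  BddMeas.of_continuous ((entry i j).continuous.comp hF)

/-- An entry passes under the Bochner integral only once `F` is known to be integrable. Expanding
`F` in matrix units gives this from the bounded measurable entries. -/
theorem entry_fourierCoeffs (hF : BddMeasMat F) (i j : Fin d) (n : ℤ) :
    entry i j (fourierCoeffs F n) = scoeff (fun z => entry i j (F z)) n := by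
  obtain ⟨f, hf⟩ : ∃ f : Fin d → Fin d → ℝ → Mat d, ∀ k l θ, f k l θ =
      (((Circle.exp θ : ℂ) ^ (-n)) * entry k l (F (Circle.exp θ))) •
        MatWiener.ofMatrix (Matrix.single k l (1 : ℂ)) := ⟨_, fun _ _ _ => rfl⟩
  have hsm : ∀ k l, IntervalIntegrable (f k l) volume 0 (2 * Real.pi) := fun k l => by
    obtain ⟨C, hC⟩ := (hF k l).bounded
    have hm : Measurable fun θ : ℝ => ((Circle.exp θ : ℂ) ^ (-n)) *
        entry k l (F (Circle.exp θ)) :=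
      ((BddMeas.continuous_zpow (-n)).comp Circle.exp.continuous).measurable.mul
        (hF k l).measurable
    have h1 : IntervalIntegrable (fun θ : ℝ => ((Circle.exp θ : ℂ) ^ (-n)) *
        entry k l (F (Circle.exp θ))) volume 0 (2 * Real.pi) := by
      refine IntervalIntegrable.mono_fun' (g := fun _ => C) intervalIntegrable_const
        hm.aestronglyMeasurable (Eventually.of_forall fun θ => ?_)
      dsimp only
      rw [norm_mul, norm_zpow, Circle.norm_coe, one_zpow, one_mul]
      exact hC _
    rw [show f k l = _ from funext (hf k l)]
    exact ⟨h1.1.smul_const _, h1.2.smul_const _⟩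
  have hint : IntervalIntegrable (fun θ : ℝ => ((Circle.exp θ : ℂ) ^ (-n)) • F (Circle.exp θ))
      volume 0 (2 * Real.pi) := by
    have h1 : ∀ k, IntervalIntegrable (∑ l, f k l) volume 0 (2 * Real.pi) := fun k =>
      IntervalIntegrable.sum (f := f k) Finset.univ fun l _ => hsm k l
    have h2 : IntervalIntegrable (∑ k, ∑ l, f k l) volume 0 (2 * Real.pi) :=
      IntervalIntegrable.sum (f := fun k => ∑ l, f k l) Finset.univ fun k _ => h1 k
    convert h2 using 1
    funext θ
    simp only [Finset.sum_apply, hf, mul_smul, ← Finset.smul_sum]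
    rw [← mat_eq_sum]
  have h := (entry i j).intervalIntegral_comp_comm hint
  simp only [map_smul, smul_eq_mul] at h
  rw [scoeff_eq_intervalIntegral, h]
  exact (entry i j).map_smul _ _

theorem fourierCoeffs_add (hF : BddMeasMat F) (hG : BddMeasMat G) (n : ℤ) :
    fourierCoeffs (fun z => F z + G z) n = fourierCoeffs F n + fourierCoeffs G n := by
  refine mat_ext fun i j => ?_
  rw [map_add, (hF.add hG).entry_fourierCoeffs, hF.entry_fourierCoeffs, hG.entry_fourierCoeffs]
  have := congrFun (fourierCoeff.add (((hF i j).memLp 1).integrable le_rfl)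
    (((hG i j).memLp 1).integrable le_rfl)) n
  rw [Pi.add_apply] at this
  rw [scoeff, scoeff, scoeff, ← this]
  simp only [map_add]
  rfl

/-- The Fourier coefficients of a product. -/
theorem hasSum_fourierCoeffs_mul (hF : BddMeasMat F) (hG : BddMeasMat G) (n : ℤ) (x : Vec d) :
    HasSum (fun k => fourierCoeffs F (n - k) (fourierCoeffs G k x))
      (fourierCoeffs (fun z => F z * G z) n x) := by
  let e := EuclideanSpace.equiv (Fin d) ℂ
  have h : HasSum (fun k => e (fourierCoeffs F (n - k) (fourierCoeffs G k x)))
      (e (fourierCoeffs (fun z => F z * G z) n x)) := by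
    refine Pi.hasSum.2 fun i => ?_
    change HasSum (fun k => (fourierCoeffs F (n - k) (fourierCoeffs G k x)) i)
      ((fourierCoeffs (fun z => F z * G z) n x) i)
    simp only [apply_eq_sum_entry, hF.entry_fourierCoeffs, hG.entry_fourierCoeffs,
      (hF.mul hG).entry_fourierCoeffs]
    have h1 : ∀ j, scoeff (fun z => entry i j (F z * G z)) n =
        ∑ l, scoeff (fun z => entry i l (F z) * entry l j (G z)) n := fun j => by
      have h2 : (fun z => entry i j (F z * G z)) =
          fun z => ∑ l, entry i l (F z) * entry l j (G z) := funext fun z => entry_mul _ _ _ _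
      have := congrFun (fourierCoeff.sum Finset.univ
        (fun l => pullback fun z => entry i l (F z) * entry l j (G z)) fun l _ =>
          ((((hF i l).mul (hG l j)).memLp 1).integrable le_rfl)) n
      rw [Finset.sum_apply] at this
      simp only [h2, scoeff]
      rw [← this]
      congr 1
      funext t
      rw [Finset.sum_apply]
      rfl
    have h3 : (fun k => ∑ l, scoeff (fun z => entry i l (F z)) (n - k) *
        ∑ j, scoeff (fun z => entry l j (G z)) k * x j) = fun k => ∑ j, ∑ l,
        (scoeff (fun z => entry i l (F z)) (n - k) * scoeff (fun z => entry l j (G z)) k) * x j := by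
      funext k
      rw [Finset.sum_comm]
      simp only [Finset.mul_sum, mul_assoc]
    rw [h3]
    simp only [h1, Finset.sum_mul]
    exact hasSum_sum fun j _ => hasSum_sum fun l _ =>
      ((hF i l).hasSum_scoeff_mul (hG l j) n).mul_right _
  exact (e.hasSum (y := e (fourierCoeffs (fun z => F z * G z) n x))).1 h

theorem ae_eq_zero (hF : BddMeasMat F) (h : ∀ n, fourierCoeffs F n = 0) :
    ∀ᵐ θ : ℝ ∂(volume.restrict (Ioc 0 (2 * Real.pi))), F (Circle.exp θ) = 0 := by
  have h1 : ∀ i j, ∀ᵐ θ : ℝ ∂(volume.restrict (Ioc 0 (2 * Real.pi))),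
      entry i j (F (Circle.exp θ)) = 0 := fun i j =>
    (hF i j).ae_eq_zero fun n => by rw [← hF.entry_fourierCoeffs, h, map_zero]
  have h2 := ae_all_iff.2 fun i => ae_all_iff.2 fun j => h1 i j
  filter_upwards [h2] with θ hθ
  exact mat_ext fun i j => by rw [hθ i j, map_zero]

end BddMeasMat

theorem fourierCoeffs_eval (M : MatWiener d) (n : ℤ) :
    fourierCoeffs (fun z => MatWiener.eval z M) n = MatWiener.coeffMat n M := by
  refine mat_ext fun i j => ?_
  rw [(BddMeasMat.of_continuous (MatWiener.continuous_eval_left M)).entry_fourierCoeffs,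
    MatWiener.coeffMat, entry_ofMatrix, Matrix.map_apply, ← scoeff_eval]
  simp only [MatWiener.eval_apply, entry_ofMatrix]
  rfl

end Entries

/-! ### Products of convolution operators -/

section ConvOp

variable {d : ℕ} {p : ℝ≥0∞} [Fact (1 ≤ p)] {X : Submodule ℂ (SeqLp d p)}

/-- Sequences with a single nonzero term. -/
def sing (X : Submodule ℂ (SeqLp d p)) [hX : Admissible X] (n : ℤ) (x : Vec d) : X :=
  ⟨lp.single p n x, hX.single_mem n x⟩

variable [hX : Admissible X]

theorem sing_apply (n : ℤ) (x : Vec d) (k : ℤ) :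
    (sing X n x : SeqLp d p) k = if k = n then x else 0 := by
  change (lp.single (E := fun _ : ℤ => Vec d) p n x) k = _
  rw [lp.coeFn_single, Pi.single_apply]

theorem IsConvOp.apply_sing {T : X →L[ℂ] X} {a : ℤ → Mat d} (hT : IsConvOp T a) (m : ℤ)
    (x : Vec d) (n : ℤ) : (T (sing X m x) : SeqLp d p) n = a (n - m) x := by
  refine (hT (sing X m x) n).unique ?_
  convert hasSum_ite_eq m (a (n - m) x) using 2 with k
  rw [sing_apply]
  split_ifs with h
  · rw [h]
  · rw [map_zero]

omit hX in
theorem IsConvOp.eq {S T : X →L[ℂ] X} {a : ℤ → Mat d} (hS : IsConvOp S a) (hT : IsConvOp T a) :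
    S = T :=
  ContinuousLinearMap.ext fun u => Subtype.ext (lp.ext (funext fun n =>
    (hS u n).unique (hT u n)))

/-- On spaces with the supremum norm, the coefficients of a convolution operator are summable. -/
theorem IsConvOp.summable_norm (hp : p = ∞) {T : X →L[ℂ] X} {a : ℤ → Mat d} (hT : IsConvOp T a) :
    Summable fun n => ‖a n‖ := by
  subst hp
  have key : ∀ i j, Summable fun m => ‖entry i j (a (0 - m))‖ := fun i j => by
    -- Phases that make the terms of the zeroth coordinate add up without cancellation. Where the
    -- entry is zero, division by zero gives the phase `0`, which does no harm.
    let ph : ℤ → ℂ := fun m => (starRingEnd ℂ) (entry i j (a (0 - m))) / ‖entry i j (a (0 - m))‖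
    have hph : ∀ m, ‖ph m‖ ≤ 1 := fun m => by
      simp only [ph, norm_div, RCLike.norm_conj, Complex.norm_real, norm_norm]
      exact div_self_le_one _
    have hph2 : ∀ m, entry i j (a (0 - m)) * ph m = (‖entry i j (a (0 - m))‖ : ℂ) := fun m => by
      simp only [ph]
      rw [← mul_div_assoc, Complex.mul_conj, Complex.normSq_eq_norm_sq]
      push_cast
      rw [sq, mul_self_div_self]
    refine summable_of_sum_le (c := ‖T‖) (fun _ => norm_nonneg _) fun s => ?_
    let u : X := ∑ m ∈ s, sing X m (ph m • EuclideanSpace.single j (1 : ℂ))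
    have hu : ∀ n, (u : SeqLp d ∞) n =
        if n ∈ s then ph n • EuclideanSpace.single j (1 : ℂ) else 0 := fun n => by
      change coord X n u = _
      rw [map_sum]
      simp only [coord_apply, sing_apply]
      rw [Finset.sum_ite_eq]
    have hu1 : ‖u‖ ≤ 1 := by
      refine lp.norm_le_of_forall_le (f := (u : SeqLp d ∞)) zero_le_one fun n => ?_
      rw [hu]
      split_ifs
      · rw [norm_smul, PiLp.norm_single, norm_one, mul_one]
        exact hph n
      · rw [norm_zero]; exact zero_le_one
    have h1 : (coord X 0 (T u)) i = ((∑ m ∈ s, ‖entry i j (a (0 - m))‖ : ℝ) : ℂ) := by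
      rw [map_sum, map_sum]
      simp only [coord_apply, hT.apply_sing, map_smul]
      rw [WithLp.ofLp_sum, Finset.sum_apply, Complex.ofReal_sum]
      refine Finset.sum_congr rfl fun m _ => ?_
      rw [← hph2, PiLp.smul_apply, entry_apply, smul_eq_mul, mul_comm]
    have h2 : ‖(coord X 0 (T u)) i‖ ≤ ‖T‖ := by
      refine (PiLp.norm_apply_le _ i).trans ?_
      refine (lp.norm_apply_le_norm (by simp) (T u : SeqLp d ∞) 0).trans ?_
      exact (T.le_opNorm u).trans (mul_le_of_le_one_right (norm_nonneg T) hu1)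
    rw [h1, Complex.norm_real] at h2
    exact (le_abs_self _).trans h2
  obtain ⟨C, hC⟩ := norm_le_sum_entry (d := d)
  have h1 : Summable fun m => ‖a (0 - m)‖ :=
    ((summable_sum fun i _ => summable_sum fun j _ => key i j).mul_left C).of_nonneg_of_le
      (fun _ => norm_nonneg _) fun m => hC _
  have h2 := (Equiv.neg ℤ).summable_iff.2 h1
  simpa [Function.comp_def] using h2

/-- For `p = ∞` both coefficient families are absolutely summable, so the order of summation can be
exchanged. For `p < ∞` the finite sequences are dense, so it is enough to apply the product to
sequences with one nonzero term, where `hc` is exactly what is needed. -/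
theorem IsConvOp.mul {S T : X →L[ℂ] X} {a b c : ℤ → Mat d} (hS : IsConvOp S a) (hT : IsConvOp T b)
    (hc : ∀ n x, HasSum (fun k => a (n - k) (b k x)) (c n x)) : IsConvOp (S * T) c := by
  have hc' : ∀ n k x, HasSum (fun j => a (n - j) (b (j - k) x)) (c (n - k) x) := fun n k x => by
    have := (Equiv.subRight k).hasSum_iff.2 (hc (n - k) x)
    convert! this using 2 with j
    simp
  intro u n
  by_cases hp : p = ∞
  · have ha := hS.summable_norm hp
    have hb := hT.summable_norm hp
    have hsum : Summable fun q : ℤ × ℤ => a (n - q.1) (b (q.1 - q.2) ((u : SeqLp d p) q.2)) := by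
      have h1 : Summable fun q : ℤ × ℤ => ‖a q.1‖ * ‖b q.2‖ :=
        ha.mul_of_nonneg hb (fun _ => norm_nonneg _) fun _ => norm_nonneg _
      have hinj : Function.Injective fun q : ℤ × ℤ => (n - q.1, q.1 - q.2) := by
        rintro ⟨j, k⟩ ⟨j', k'⟩ h
        simp only [Prod.mk.injEq] at h ⊢
        omega
      refine Summable.of_norm_bounded ((h1.comp_injective hinj).mul_right ‖u‖) fun q => ?_
      refine ((a (n - q.1)).le_opNorm _).trans ?_
      rw [Function.comp_apply, mul_assoc]
      refine mul_le_mul_of_nonneg_left ((b _).le_opNorm_of_le ?_) (norm_nonneg _)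
      exact lp.norm_apply_le_norm (zero_lt_one.trans_le (Fact.out : 1 ≤ p)).ne' (u : SeqLp d p) q.2
    have h1 := hsum.hasSum.prod_fiberwise fun j => (a (n - j)).hasSum (hT u j)
    have h2 := ((Equiv.prodComm ℤ ℤ).hasSum_iff.2 hsum.hasSum).prod_fiberwise
      fun k => hc' n k ((u : SeqLp d p) k)
    rw [h1.unique (hS (T u) n)] at h2
    exact h2
  -- Here `X` is all of `ℓ_p`; the expansion of `u` into unit sequences converges in norm and can be
  -- pushed through the product.
  · let incl : SeqLp d p →L[ℂ] X := (ContinuousLinearMap.id ℂ _).codRestrict X fun v => by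
      rw [hX.eq_top hp]; trivial
    let L : SeqLp d p →L[ℂ] Vec d := (coord X n).comp ((S * T).comp incl)
    have h := L.hasSum (lp.hasSum_single hp (u : SeqLp d p))
    have h1 : ∀ k x, L (lp.single p k x) = c (n - k) x := fun k x => by
      have h2 := hS (T (sing X k x)) n
      simp only [hT.apply_sing] at h2
      exact h2.unique (hc' n k x)
    simp only [h1] at h
    exact h

end ConvOp

/-! ### Convolution operators with bounded measurable symbols -/

section Symbol

variable {d : ℕ} {p : ℝ≥0∞} [Fact (1 ≤ p)] {X : Submodule ℂ (SeqLp d p)}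

/-- `T` is the convolution operator with the bounded measurable symbol `F`. -/
structure HasSymbol (T : X →L[ℂ] X) (F : Circle → Mat d) : Prop where
  bddMeasMat : BddMeasMat F
  isConvOp : IsConvOp T (fourierCoeffs F)

namespace HasSymbol

variable {S T : X →L[ℂ] X} {F G : Circle → Mat d}

theorem congr (hT : HasSymbol T F) (h : ∀ z, F z = G z) : HasSymbol T G := by
  rwa [show G = F from funext fun z => (h z).symm]

theorem add (hS : HasSymbol S F) (hT : HasSymbol T G) : HasSymbol (S + T) fun z => F z + G z := by
  refine ⟨hS.1.add hT.1, fun u n => ?_⟩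
  convert! (hS.2 u n).add (hT.2 u n) using 2 with k
  rw [hS.1.fourierCoeffs_add hT.1]
  rfl

theorem eq (hS : HasSymbol S F) (hT : HasSymbol T G) (h : ∀ z, F z = G z) : S = T :=
  hS.2.eq (hT.congr fun z => (h z).symm).2

variable [hX : Admissible X]

theorem mul (hS : HasSymbol S F) (hT : HasSymbol T G) : HasSymbol (S * T) fun z => F z * G z :=
  ⟨hS.1.mul hT.1, hS.2.mul hT.2 (hS.1.hasSum_fourierCoeffs_mul hT.1)⟩

variable (X) in
theorem act (M : MatWiener d) : HasSymbol (act X M) fun z => MatWiener.eval z M := by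
  refine ⟨BddMeasMat.of_continuous (MatWiener.continuous_eval_left M), ?_⟩
  have h := isConvOp_act X M
  simp only [← fourierCoeffs_eval] at h
  exact h

variable (X) in
theorem one : HasSymbol (1 : X →L[ℂ] X) fun _ => 1 := by
  have := act X 1
  simpa only [map_one] using this

theorem smul (c : ℂ) (hT : HasSymbol T F) : HasSymbol (c • T) fun z => c • F z := by
  have h1 : BlockConv.act X (c • 1) * T = c • T := by
    rw [map_smul, map_one]; rfl
  rw [← h1]
  refine ((act X (c • 1)).mul hT).congr fun z => ?_
  rw [map_smul, map_one, smul_mul_assoc, one_mul]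

theorem sub (hS : HasSymbol S F) (hT : HasSymbol T G) : HasSymbol (S - T) fun z => F z - G z := by
  have h1 : S + (-1 : ℂ) • T = S - T :=
    ContinuousLinearMap.ext fun u => by simp [sub_eq_add_neg]
  rw [← h1]
  refine (hS.add (hT.smul (-1))).congr fun z =>
    ContinuousLinearMap.ext fun u => by simp [sub_eq_add_neg]

theorem sum {ι : Type*} (s : Finset ι) {T : ι → X →L[ℂ] X} {F : ι → Circle → Mat d}
    (h : ∀ i ∈ s, HasSymbol (T i) (F i)) : HasSymbol (∑ i ∈ s, T i) fun z => ∑ i ∈ s, F i z := by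
  classical
  induction s using Finset.induction_on with
  | empty =>
    simp only [Finset.sum_empty]
    have := act X (0 : MatWiener d)
    simpa only [map_zero] using this
  | insert a s ha ih =>
    simp only [Finset.sum_insert ha]
    exact (h a (Finset.mem_insert_self a s)).add
      (ih fun i hi => h i (Finset.mem_insert_of_mem hi))

theorem ae_eq_zero (hT : HasSymbol (0 : X →L[ℂ] X) F) :
    ∀ᵐ θ : ℝ ∂(volume.restrict (Ioc 0 (2 * Real.pi))), F (Circle.exp θ) = 0 := by
  refine hT.1.ae_eq_zero fun n => ContinuousLinearMap.ext fun x => ?_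
  have := hT.2.apply_sing 0 x n
  rw [sub_zero] at this
  exact this.symm

end HasSymbol

/-- On `ℓ_2`, every bounded measurable function is the symbol of a convolution operator. -/
theorem BddMeasMat.exists_isConvOp [hX : Admissible X] (hp : p = 2) {F : Circle → Mat d}
    (hF : BddMeasMat F) : ∃ T : X →L[ℂ] X, IsConvOp T (fourierCoeffs F) := by
  subst hp
  choose T hT using fun i j => (hF i j).exists_clm
  let ι : Fin d → ℂ →L[ℂ] Vec d := fun i =>
    ContinuousLinearMap.toSpanSingleton ℂ (EuclideanSpace.single i (1 : ℂ))
  let B : SeqLp d 2 →L[ℂ] SeqLp d 2 := ∑ i, ∑ j,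
    (pointwise 2 (ι i)).comp ((T i j).comp (pointwise 2 (EuclideanSpace.proj j : Vec d →L[ℂ] ℂ)))
  have hB : ∀ u n, HasSum (fun k => fourierCoeffs F (n - k) (u k)) (B u n) := fun u n => by
    have h1 : B u n = ∑ i, ∑ j,
        ι i (T i j (pointwise 2 (EuclideanSpace.proj j : Vec d →L[ℂ] ℂ) u) n) := by
      change lp.evalCLM ℂ (fun _ : ℤ => Vec d) 2 n (B u) = _
      simp only [B, sum_apply, map_sum]
      rfl
    have h2 : ∀ k, fourierCoeffs F (n - k) (u k) = ∑ i, ∑ j,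
        ι i (scoeff (fun z => entry i j (F z)) (n - k) * (u k) j) := fun k => by
      conv_lhs => rw [vec_eq_sum (fourierCoeffs F (n - k) (u k))]
      refine Finset.sum_congr rfl fun i _ => ?_
      rw [apply_eq_sum_entry, Finset.sum_smul]
      simp only [hF.entry_fourierCoeffs]
      rfl
    rw [h1]
    simp only [h2]
    exact hasSum_sum fun i _ => hasSum_sum fun j _ => (ι i).hasSum (hT i j _ n)
  have hX' : ∀ v : SeqLp d 2, v ∈ X := fun v => by rw [hX.eq_top (by simp)]; trivial
  exact ⟨restrictTo B X fun v _ => hX' _, fun u n => hB u n⟩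

end Symbol

/-! ### Moments of the resolvent -/

section Moments

variable {R S : Type*} [NormedRing R] [NormedAlgebra ℂ R] [CompleteSpace R]
  [NormedRing S] [NormedAlgebra ℂ S] [CompleteSpace S]

theorem circleIntegral_clm_comm {E F : Type*} [NormedAddCommGroup E] [NormedSpace ℂ E]
    [CompleteSpace E] [NormedAddCommGroup F] [NormedSpace ℂ F] [CompleteSpace F] (L : E →L[ℂ] F)
    {f : ℂ → E} {c : ℂ} {r : ℝ} (hf : CircleIntegrable f c r) :
    L (∮ ζ in C(c, r), f ζ) = ∮ ζ in C(c, r), L (f ζ) := by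
  rw [circleIntegral, ← L.intervalIntegral_comp_comm hf.out, circleIntegral]
  simp only [map_smul]

/-- The integral `(2πi)⁻¹ ∮ (ζ - c)ⁿ (ζ - m)⁻¹ dζ` over the circle `|ζ - c| = r`. For `n = 0` and
a circle in the resolvent set of `m`, it is the Riesz projection. -/
def moment (c : ℂ) (r : ℝ) (n : ℤ) (m : R) : R :=
  (2 * Real.pi * Complex.I : ℂ)⁻¹ • ∮ ζ in C(c, r), (ζ - c) ^ n • resolvent m ζ

variable {c : ℂ} {r : ℝ}

theorem continuousOn_resolvent (hr : 0 < r) {m : R}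
    (hm : Metric.sphere c r ⊆ resolventSet ℂ m) (n : ℤ) :
    ContinuousOn (fun ζ => (ζ - c) ^ n • resolvent m ζ) (Metric.sphere c r) := by
  refine ContinuousOn.smul ?_ fun ζ hζ =>
    (spectrum.hasDerivAt_resolvent_const_left (hm hζ)).continuousAt.continuousWithinAt
  refine ContinuousOn.zpow₀ (by fun_prop) _ fun ζ hζ => Or.inl ?_
  rw [sub_ne_zero]
  rintro rfl
  simp at hζ
  exact hr.ne hζ

theorem circleIntegrable_resolvent (hr : 0 < r) {m : R}
    (hm : Metric.sphere c r ⊆ resolventSet ℂ m) (n : ℤ) :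
    CircleIntegrable (fun ζ => (ζ - c) ^ n • resolvent m ζ) c r :=
  (continuousOn_resolvent hr hm n).circleIntegrable hr.le

theorem clm_moment {E : Type*} [NormedAddCommGroup E] [NormedSpace ℂ E]
    [CompleteSpace E] (L : R →L[ℂ] E) (hr : 0 < r) {m : R}
    (hm : Metric.sphere c r ⊆ resolventSet ℂ m) (n : ℤ) :
    L (moment c r n m) =
      (2 * Real.pi * Complex.I : ℂ)⁻¹ • ∮ ζ in C(c, r), (ζ - c) ^ n • L (resolvent m ζ) := by
  rw [moment, map_smul, circleIntegral_clm_comm L (circleIntegrable_resolvent hr hm n)]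
  simp only [map_smul]

omit [CompleteSpace R] [CompleteSpace S] in
theorem map_resolvent (f : R →ₐ[ℂ] S) {m : R} {ζ : ℂ} (h : ζ ∈ resolventSet ℂ m) :
    f (resolvent m ζ) = resolvent (f m) ζ := by
  have h1 : IsUnit (algebraMap ℂ R ζ - m) := h
  obtain ⟨u, hu⟩ := h1
  rw [resolvent, resolvent, ← hu, Ring.inverse_unit, ← AlgHom.commutes f, ← map_sub, ← hu]
  exact (Ring.inverse_unit (Units.map (f : R →* S) u)).symm

/-- Applied to evaluation at `z`: moments formed once over the Wiener algebra become pointwise the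
moments of the matrices `A(z)`. -/
theorem map_moment (f : R →ₐ[ℂ] S) (hf : Continuous f) (hr : 0 < r) {m : R}
    (hm : Metric.sphere c r ⊆ resolventSet ℂ m) (n : ℤ) :
    f (moment c r n m) = moment c r n (f m) := by
  have h := clm_moment (⟨f.toLinearMap, hf⟩ : R →L[ℂ] S) hr hm n
  change f (moment c r n m) = _ at h
  rw [h, moment]
  congr 1
  refine circleIntegral.integral_congr hr.le fun ζ hζ => ?_
  change _ • f (resolvent m ζ) = _
  rw [map_resolvent f (hm hζ)]

omit [CompleteSpace R] in
theorem resolvent_mul_sub {m : R} {ζ : ℂ} (h : ζ ∈ resolventSet ℂ m) :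
    resolvent m ζ * (algebraMap ℂ R ζ - m) = 1 := Ring.inverse_mul_cancel _ h

omit [CompleteSpace R] in
theorem sub_mul_resolvent {m : R} {ζ : ℂ} (h : ζ ∈ resolventSet ℂ m) :
    (algebraMap ℂ R ζ - m) * resolvent m ζ = 1 := Ring.mul_inverse_cancel _ h

theorem zpow_circleIntegral (hr : 0 < r) (n : ℤ) :
    (2 * Real.pi * Complex.I : ℂ)⁻¹ • ∮ ζ in C(c, r), (ζ - c) ^ n • (1 : R) =
      if n = -1 then 1 else 0 := by
  rw [circleIntegral.integral_smul_const]
  split_ifs with h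
  · subst h
    simp only [zpow_neg_one]
    rw [circleIntegral.integral_sub_center_inv _ hr.ne', smul_smul,
      inv_mul_cancel₀ Complex.two_pi_I_ne_zero, one_smul]
  · rw [circleIntegral.integral_sub_zpow_of_ne h, zero_smul, smul_zero]

omit [CompleteSpace R] in
theorem smul_resolvent (hr : 0 < r) (n : ℤ) {ζ : ℂ} (hζ : ζ ∈ Metric.sphere c r) (x : R) :
    (ζ - c) ^ n • (ζ - c) • x = (ζ - c) ^ (n + 1) • x := by
  have h : ζ - c ≠ 0 := by
    rw [sub_ne_zero]
    rintro rfl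
    simp at hζ
    exact hr.ne hζ
  rw [smul_smul, zpow_add_one₀ h]

/-- Write `m - c = (ζ - c) - (ζ - m)`. The first term raises the order by one; the second cancels
the resolvent and leaves `∮ (ζ - c)ⁿ dζ`, which is nonzero only for `n = -1`. -/
theorem sub_mul_moment (hr : 0 < r) {m : R} (hm : Metric.sphere c r ⊆ resolventSet ℂ m) (n : ℤ) :
    (m - algebraMap ℂ R c) * moment c r n m = moment c r (n + 1) m - if n = -1 then 1 else 0 := by
  have h := clm_moment (ContinuousLinearMap.mul ℂ R (m - algebraMap ℂ R c)) hr hm n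
  rw [ContinuousLinearMap.mul_apply'] at h
  rw [h, ← zpow_circleIntegral (R := R) (c := c) hr n, moment, ← smul_sub,
    ← circleIntegral.integral_sub (circleIntegrable_resolvent hr hm _)]
  · congr 1
    refine circleIntegral.integral_congr hr.le fun ζ hζ => ?_
    have h1 : m - algebraMap ℂ R c = (ζ - c) • (1 : R) - (algebraMap ℂ R ζ - m) := by
      rw [sub_smul, ← Algebra.algebraMap_eq_smul_one, ← Algebra.algebraMap_eq_smul_one]; abel
    rw [ContinuousLinearMap.mul_apply', h1, sub_mul, sub_mul_resolvent (hm hζ), smul_mul_assoc,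
      one_mul, smul_sub, smul_resolvent hr n hζ]
  · refine ContinuousOn.circleIntegrable hr.le (ContinuousOn.smul ?_ continuousOn_const)
    refine ContinuousOn.zpow₀ (by fun_prop) _ fun ζ hζ => Or.inl ?_
    rw [sub_ne_zero]
    rintro rfl
    simp at hζ
    exact hr.ne hζ

theorem commute_moment (hr : 0 < r) {m : R} (hm : Metric.sphere c r ⊆ resolventSet ℂ m) (n : ℤ) :
    Commute m (moment c r n m) := by
  have h := clm_moment (ContinuousLinearMap.mul ℂ R m) hr hm n
  have h' := clm_moment ((ContinuousLinearMap.mul ℂ R).flip m) hr hm n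
  rw [ContinuousLinearMap.mul_apply'] at h
  rw [ContinuousLinearMap.flip_apply, ContinuousLinearMap.mul_apply'] at h'
  refine h.trans (Eq.trans ?_ h'.symm)
  congr 1
  refine circleIntegral.integral_congr hr.le fun ζ hζ => ?_
  rw [ContinuousLinearMap.flip_apply, ContinuousLinearMap.mul_apply', ContinuousLinearMap.mul_apply']
  congr 1
  have h1 := sub_mul_resolvent (hm hζ)
  have h2 := resolvent_mul_sub (hm hζ)
  rw [sub_mul, Algebra.commutes] at h1
  rw [mul_sub] at h2
  exact sub_right_injective (h1.trans h2.symm)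

/-- On the contour `|ζ - c| = r`, so the moments grow at most geometrically with ratio `r`. This
rate is later played against the norm of a left inverse. -/
theorem norm_moment_le (hr : 0 < r) {m : R} (hm : Metric.sphere c r ⊆ resolventSet ℂ m) :
    ∃ C : ℝ, ∀ n : ℕ, ‖moment c r (n : ℤ) m‖ ≤ C * r ^ n := by
  obtain ⟨C, hC⟩ := (isCompact_sphere c r).exists_bound_of_continuousOn
    (continuousOn_resolvent hr hm 0)
  refine ⟨r * C, fun n => ?_⟩
  have h : ∀ ζ ∈ Metric.sphere c r, ‖(ζ - c) ^ (n : ℤ) • resolvent m ζ‖ ≤ r ^ n * C := fun ζ hζ => by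
    have h1 := hC ζ hζ
    rw [zpow_zero, one_smul] at h1
    rw [norm_smul, zpow_natCast, norm_pow, ← dist_eq_norm, Metric.mem_sphere.1 hζ]
    exact mul_le_mul_of_nonneg_left h1 (by positivity)
  refine (circleIntegral.norm_two_pi_i_inv_smul_integral_le_of_norm_le_const hr.le h).trans
    (le_of_eq (by ring))

end Moments

/-! ### Upper triangular matrices -/

namespace SchurData

variable {d : ℕ} {a : Circle → Mat d} (s : SchurData a)

/-- The matrix entries `⟨φ_j(z), x φ_l(z)⟩` in the Schur basis. -/
def mc (z : Circle) (j l : Fin d) : Mat d →L[ℂ] ℂ :=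
  (innerSL ℂ (s.phi j z)).comp (ContinuousLinearMap.apply ℂ (Vec d) (s.phi l z))

theorem mc_apply (z : Circle) (j l : Fin d) (x : Mat d) :
    s.mc z j l x = inner ℂ (s.phi j z) (x (s.phi l z)) := rfl

theorem inner_phi (z : Circle) (j l : Fin d) :
    inner ℂ (s.phi j z) (s.phi l z) = if j = l then (1 : ℂ) else 0 :=
  orthonormal_iff_ite.1 (s.orthonormal z) j l

/-- The Schur vectors as an orthonormal basis. -/
def onb (z : Circle) : OrthonormalBasis (Fin d) ℂ (Vec d) :=
  OrthonormalBasis.mk (s.orthonormal z) (by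
    rw [top_le_iff]
    exact (s.orthonormal z).linearIndependent.span_eq_top_of_card_eq_finrank' (by simp))

theorem onb_apply (z : Circle) (j : Fin d) : s.onb z j = s.phi j z := by
  rw [onb, OrthonormalBasis.coe_mk]

theorem sum_inner_smul (z : Circle) (x : Vec d) :
    ∑ i, (inner ℂ (s.phi i z) x : ℂ) • s.phi i z = x := by
  have := (s.onb z).sum_repr' x
  simpa only [onb_apply] using this

theorem mc_ext (z : Circle) {x y : Mat d} (h : ∀ j l, s.mc z j l x = s.mc z j l y) : x = y := by
  have h1 : ∀ l, x (s.phi l z) = y (s.phi l z) := fun l => by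
    rw [← s.sum_inner_smul z (x (s.phi l z)), ← s.sum_inner_smul z (y (s.phi l z))]
    exact Finset.sum_congr rfl fun j _ => by rw [← mc_apply, ← mc_apply, h]
  refine ContinuousLinearMap.ext fun v => ?_
  rw [← s.sum_inner_smul z v, map_sum, map_sum]
  exact Finset.sum_congr rfl fun j _ => by rw [map_smul, map_smul, h1]

theorem mc_mul (z : Circle) (j l : Fin d) (x y : Mat d) :
    s.mc z j l (x * y) = ∑ i, s.mc z j i x * s.mc z i l y := by
  rw [mc_apply, mul_apply_eq_comp, ← s.sum_inner_smul z (y (s.phi l z)), map_sum, inner_sum]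
  refine Finset.sum_congr rfl fun i _ => ?_
  rw [map_smul, inner_smul_right, mul_comm, ← mc_apply]
  rfl

theorem mc_one (z : Circle) (j l : Fin d) : s.mc z j l 1 = if j = l then 1 else 0 := by
  rw [mc_apply, one_apply_eq_self, inner_phi]

/-- The orthogonal projection onto the span of the Schur vectors with indices in `I`. -/
def proj (I : Finset (Fin d)) (z : Circle) : Mat d := ∑ l ∈ I, s.deltaP l z

theorem mc_deltaP (z : Circle) (i j l : Fin d) :
    s.mc z j l (s.deltaP i z) = if j = l then (if j = i then 1 else 0) else 0 := by
  rw [mc_apply, deltaP]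
  simp only [ContinuousLinearMap.smulRight_apply, innerSL_apply_apply, inner_smul_right, inner_phi]
  split_ifs <;> simp_all

theorem mc_proj (z : Circle) (I : Finset (Fin d)) (j l : Fin d) :
    s.mc z j l (s.proj I z) = if j = l then (if j ∈ I then 1 else 0) else 0 := by
  rw [proj, map_sum]
  simp only [mc_deltaP]
  split_ifs with h h1 <;> simp_all

theorem mc_proj_mul (z : Circle) (I : Finset (Fin d)) (j l : Fin d) (x : Mat d) :
    s.mc z j l (s.proj I z * x) = if j ∈ I then s.mc z j l x else 0 := by
  rw [mc_mul, Finset.sum_eq_single j] <;> simp +contextual [mc_proj, eq_comm]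

theorem mc_mul_proj (z : Circle) (I : Finset (Fin d)) (j l : Fin d) (x : Mat d) :
    s.mc z j l (x * s.proj I z) = if l ∈ I then s.mc z j l x else 0 := by
  rw [mc_mul, Finset.sum_eq_single l] <;> simp +contextual [mc_proj, eq_comm]

theorem proj_mul_proj (z : Circle) (I : Finset (Fin d)) :
    s.proj I z * s.proj I z = s.proj I z := by
  refine s.mc_ext z fun j l => ?_
  rw [mc_proj_mul, mc_proj]
  split_ifs <;> rfl

theorem proj_univ (z : Circle) : s.proj Finset.univ z = 1 := by
  refine s.mc_ext z fun j l => ?_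
  rw [mc_proj, mc_one]
  simp

theorem one_sub_proj (z : Circle) (I : Finset (Fin d)) : 1 - s.proj I z = s.proj Iᶜ z := by
  rw [← s.proj_univ z, proj, proj, proj, sub_eq_iff_eq_add, Finset.sum_compl_add_sum]

/-- Matrices that are upper triangular in the Schur basis. -/
def Tri (z : Circle) (x : Mat d) : Prop := ∀ j l, l < j → s.mc z j l x = 0

variable {s} in
-- In the sum for entry `(j, l)` with `j, l ∈ I`, an index `i` outside the interval `I` satisfies `i
-- < j` or `l < i`, and then one of the two triangular factors vanishes. So inserting the projection
-- changes nothing.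
theorem Tri.proj_mul_mul_proj {z : Circle} {x y : Mat d} (hx : s.Tri z x) (hy : s.Tri z y)
    {I : Finset (Fin d)} (hI : (I : Set (Fin d)).OrdConnected) :
    s.proj I z * x * s.proj I z * (s.proj I z * y * s.proj I z) =
      s.proj I z * (x * y) * s.proj I z := by
  refine s.mc_ext z fun j l => ?_
  rw [mc_mul, mc_mul_proj, mc_proj_mul, mc_mul]
  simp only [mc_mul_proj, mc_proj_mul]
  by_cases hl : l ∈ I <;> by_cases hj : j ∈ I <;> simp only [hl, hj, if_true, if_false, mul_zero,
    zero_mul, ite_self, Finset.sum_const_zero]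
  refine Finset.sum_congr rfl fun i _ => ?_
  by_cases hi : i ∈ I
  · simp [hi]
  · have h : i < j ∨ l < i := by
      by_contra! h
      exact hi (hI.out hj hl ⟨h.1, h.2⟩)
    rcases h with h | h
    · rw [hx _ _ h]; simp
    · rw [hy _ _ h]; simp

theorem mc_mul_self (z : Circle) (j l : Fin d) (x : Mat d) :
    s.mc z j l (x * a z) =
      s.lam l z * s.mc z j l x + ∑ i ∈ Finset.Iio l, s.mu l i z * s.mc z j i x := by
  rw [mc_apply, mul_apply_eq_comp, s.triangular]
  simp [mc_apply]

theorem mc_self (z : Circle) (j l : Fin d) :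
    s.mc z j l (a z) = (if j = l then s.lam l z else 0) +
      ∑ i ∈ Finset.Iio l, s.mu l i z * if j = i then 1 else 0 := by
  have := s.mc_mul_self z j l 1
  rw [one_mul] at this
  rw [this]
  simp only [mc_one, mul_ite, mul_one, mul_zero]

theorem tri_self (z : Circle) : s.Tri z (a z) := fun j l h => by
  rw [mc_self, if_neg h.ne', zero_add]
  refine Finset.sum_eq_zero fun i hi => ?_
  rw [if_neg (((Finset.mem_Iio.1 hi).trans h).ne'), mul_zero]

theorem mc_self_self (z : Circle) (l : Fin d) : s.mc z l l (a z) = s.lam l z := by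
  rw [mc_self, if_pos rfl, add_eq_left]
  refine Finset.sum_eq_zero fun i hi => ?_
  rw [if_neg (Finset.mem_Iio.1 hi).ne', mul_zero]

variable {s} in
theorem Tri.sub {z : Circle} {x y : Mat d} (hx : s.Tri z x) (hy : s.Tri z y) :
    s.Tri z (x - y) := fun j l h => by rw [map_sub, hx j l h, hy j l h, sub_zero]

theorem tri_algebraMap (z : Circle) (c : ℂ) : s.Tri z (algebraMap ℂ (Mat d) c) := fun j l h => by
  rw [Algebra.algebraMap_eq_smul_one, map_smul, mc_one, if_neg h.ne', smul_zero]

/-! ### The resolvent of a triangular matrix -/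

theorem mc_resolvent {z : Circle} {ζ : ℂ} (h : ζ ∈ resolventSet ℂ (a z)) (j l : Fin d) :
    (ζ - s.lam l z) * s.mc z j l (resolvent (a z) ζ) = (if j = l then 1 else 0) +
      ∑ i ∈ Finset.Iio l, s.mu l i z * s.mc z j i (resolvent (a z) ζ) := by
  have h1 := congrArg (s.mc z j l) (resolvent_mul_sub h)
  rw [mul_sub, map_sub, mc_mul_self, mc_one, ← Algebra.commutes, Algebra.algebraMap_eq_smul_one,
    smul_mul_assoc, one_mul, map_smul, smul_eq_mul] at h1
  rw [← h1]
  ring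

/-- Column-by-column substitution. The two claims are proved together: vanishing below the diagonal
in earlier columns removes the sum in `mc_resolvent`, whose diagonal case then makes `ζ - λ_l`
invertible, and this gives vanishing in column `l`. -/
theorem lam_ne_and_mc_resolvent {z : Circle} {ζ : ℂ} (h : ζ ∈ resolventSet ℂ (a z)) (l : Fin d) :
    ζ - s.lam l z ≠ 0 ∧ ∀ j, l < j → s.mc z j l (resolvent (a z) ζ) = 0 := by
  induction l using WellFoundedLT.induction with
  | ind l ih =>
    have h0 : ∀ j, l ≤ j →
        ∑ i ∈ Finset.Iio l, s.mu l i z * s.mc z j i (resolvent (a z) ζ) = 0 := fun j hj =>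
      Finset.sum_eq_zero fun i hi => by
        rw [(ih i (Finset.mem_Iio.1 hi)).2 j ((Finset.mem_Iio.1 hi).trans_le hj), mul_zero]
    have h1 : ζ - s.lam l z ≠ 0 := by
      have h2 := s.mc_resolvent h l l
      rw [h0 l le_rfl, if_pos rfl, add_zero] at h2
      exact left_ne_zero_of_mul (h2.trans_ne one_ne_zero)
    refine ⟨h1, fun j hj => ?_⟩
    have h2 := s.mc_resolvent h j l
    rw [h0 j hj.le, if_neg hj.ne', add_zero] at h2
    exact (mul_eq_zero.1 h2).resolve_left h1

theorem tri_resolvent {z : Circle} {ζ : ℂ} (h : ζ ∈ resolventSet ℂ (a z)) :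
    s.Tri z (resolvent (a z) ζ) := fun j l => (s.lam_ne_and_mc_resolvent h l).2 j

theorem mc_resolvent_self {z : Circle} {ζ : ℂ} (h : ζ ∈ resolventSet ℂ (a z)) (l : Fin d) :
    s.mc z l l (resolvent (a z) ζ) = (ζ - s.lam l z)⁻¹ := by
  have h2 := s.mc_resolvent h l l
  rw [if_pos rfl, Finset.sum_eq_zero fun i hi => by
    rw [s.tri_resolvent h l i (Finset.mem_Iio.1 hi), mul_zero], add_zero] at h2
  exact eq_inv_of_mul_eq_one_right h2

variable {z : Circle} {c : ℂ} {r : ℝ}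

theorem tri_moment (hr : 0 < r) (h : Metric.sphere c r ⊆ resolventSet ℂ (a z)) (n : ℤ) :
    s.Tri z (moment c r n (a z)) := fun j l hjl => by
  rw [clm_moment _ hr h, circleIntegral.integral_congr hr.le (g := fun _ => (0 : ℂ)) fun ζ hζ => ?_]
  · simp [circleIntegral]
  · dsimp only
    rw [s.tri_resolvent (h hζ) j l hjl, smul_zero]

/-- The diagonal entry of the Riesz projection for an eigenvalue inside of the circle. -/
theorem mc_moment_self (hr : 0 < r) (h : Metric.sphere c r ⊆ resolventSet ℂ (a z)) {l : Fin d}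
    (hl : s.lam l z ∈ Metric.ball c r) : s.mc z l l (moment c r 0 (a z)) = 1 := by
  rw [clm_moment _ hr h, circleIntegral.integral_congr hr.le
    (g := fun ζ => (ζ - s.lam l z)⁻¹) fun ζ hζ => ?_, circleIntegral.integral_sub_inv_of_mem_ball hl,
    smul_eq_mul, inv_mul_cancel₀ Complex.two_pi_I_ne_zero]
  dsimp only
  rw [s.mc_resolvent_self (h hζ), zpow_zero, one_smul]

/-- The Riesz projection has no component in a diagonal block with spectrum outside of the
circle. -/
theorem proj_mul_moment_mul_proj (hr : 0 < r) (h : Metric.sphere c r ⊆ resolventSet ℂ (a z))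
    {I : Finset (Fin d)} (hI : (I : Set (Fin d)).OrdConnected)
    (hlam : ∀ l ∈ I, s.lam l z ∉ Metric.closedBall c r) :
    s.proj I z * moment c r 0 (a z) * s.proj I z = 0 := by
  -- Solving for the block entries of the resolvent divides only by `ζ - λ_l` with `l ∈ I`, so they
  -- extend holomorphically over the closed disc and Cauchy's theorem applies, even if other
  -- eigenvalues lie inside.
  have key : ∀ j ∈ I, ∀ l ∈ I, ∃ g : ℂ → ℂ, (∀ ζ ∈ Metric.closedBall c r, DifferentiableAt ℂ g ζ) ∧
      ∀ ζ ∈ Metric.sphere c r, s.mc z j l (resolvent (a z) ζ) = g ζ := by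
    intro j hj l
    induction l using WellFoundedLT.induction with
    | ind l ih =>
      intro hl
      have h1 : ∀ i, ∃ g : ℂ → ℂ, i < l →
          (∀ ζ ∈ Metric.closedBall c r, DifferentiableAt ℂ g ζ) ∧
          ∀ ζ ∈ Metric.sphere c r, s.mc z j i (resolvent (a z) ζ) = g ζ := fun i => by
        by_cases hil : i < l
        -- Columns `i < j` contribute zero by triangularity; the remaining `i` lie between `j` and
        -- `l`, hence in `I`, where the induction hypothesis applies.
        · by_cases hij : i < j
          · exact ⟨0, fun _ => ⟨fun ζ _ => differentiableAt_const 0,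
              fun ζ hζ => s.tri_resolvent (h hζ) j i hij⟩⟩
          · obtain ⟨g, hg⟩ := ih i hil (hI.out hj hl ⟨not_lt.1 hij, hil.le⟩)
            exact ⟨g, fun _ => hg⟩
        · exact ⟨0, fun h => (hil h).elim⟩
      choose g hg using h1
      refine ⟨fun ζ => (ζ - s.lam l z)⁻¹ * ((if j = l then 1 else 0) +
        ∑ i ∈ Finset.Iio l, s.mu l i z * g i ζ), fun ζ hζ => ?_, fun ζ hζ => ?_⟩
      · have h2 : ζ - s.lam l z ≠ 0 := by
          rw [sub_ne_zero]
          rintro rfl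
          exact hlam l hl hζ
        refine DifferentiableAt.mul (DifferentiableAt.inv (by fun_prop) h2) ?_
        refine (differentiableAt_const _).add (DifferentiableAt.fun_sum fun i hi => ?_)
        exact ((hg i (Finset.mem_Iio.1 hi)).1 ζ hζ).const_mul _
      · have h2 := s.mc_resolvent (h hζ) j l
        rw [Finset.sum_congr rfl fun i hi => by
          rw [(hg i (Finset.mem_Iio.1 hi)).2 ζ hζ]] at h2
        dsimp only
        rw [← h2, inv_mul_cancel_left₀ (s.lam_ne_and_mc_resolvent (h hζ) l).1]
  refine s.mc_ext z fun j l => ?_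
  rw [mc_mul_proj, mc_proj_mul, map_zero]
  split_ifs with hl hj
  · obtain ⟨g, hg, hg'⟩ := key j hj l hl
    rw [clm_moment _ hr h, circleIntegral.integral_congr hr.le (g := g) fun ζ hζ => ?_,
      Complex.circleIntegral_eq_zero_of_differentiable_on_off_countable hr.le countable_empty
        (fun ζ hζ => (hg ζ hζ).continuousAt.continuousWithinAt)
        (fun ζ hζ => hg ζ (Metric.ball_subset_closedBall hζ.1)), smul_zero]
    rw [hg' ζ hζ, zpow_zero, one_smul]
  · rfl
  · rfl

end SchurData

/-! ### Local spectral data -/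

namespace MatWiener

variable {d : ℕ}

/-- Constant matrix functions. -/
def const (x : Mat d) : MatWiener d := (ofMatrix.symm x).map (algebraMap ℂ Wiener)

theorem eval_const (z : Circle) (x : Mat d) : eval z (const x) = x := by
  rw [eval_apply, const, Matrix.map_map]
  convert ofMatrix.apply_symm_apply x using 2
  ext i j
  simp

/-- A circle with radius close to `e` that avoids the spectrum of a matrix. -/
theorem exists_sphere_subset (x : Mat d) (c : ℂ) {e : ℝ} (he : 0 < e) :
    ∃ r, e / 2 < r ∧ r < e ∧ Metric.sphere c r ⊆ resolventSet ℂ x := by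
  have h1 : (spectrum ℂ x).Finite := by
    rw [← AlgEquiv.spectrum_eq (ofMatrix (d := d)).symm x]
    exact Matrix.finite_spectrum _
  obtain ⟨r, hr, hr'⟩ := ((Ioo_infinite (half_lt_self he)).sdiff (h1.image fun ζ => dist ζ c)).nonempty
  refine ⟨r, hr.1, hr.2, fun ζ hζ => ?_⟩
  by_contra h
  exact hr' ⟨ζ, h, hζ⟩

/-- If a circle avoids the spectrum of `x`, then it avoids the spectrum of all matrices close
to `x`. -/
theorem exists_ball_sphere_subset {x : Mat d} {c : ℂ} {r : ℝ}
    (h : Metric.sphere c r ⊆ resolventSet ℂ x) :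
    ∃ δ > 0, ∀ y : Mat d, ‖y - x‖ < δ → Metric.sphere c r ⊆ resolventSet ℂ y := by
  have ho : IsOpen {q : Mat d × ℂ | IsUnit (algebraMap ℂ (Mat d) q.2 - q.1)} :=
    Units.isOpen.preimage
      (((continuous_algebraMap ℂ (Mat d)).comp continuous_snd).sub continuous_fst)
  obtain ⟨u, v, hu, -, hxu, hsv, huv⟩ := generalized_tube_lemma (isCompact_singleton (x := x))
    (isCompact_sphere c r) ho (by
      rintro ⟨y, ζ⟩ ⟨hy, hζ⟩
      obtain rfl : y = x := hy
      exact h hζ)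
  obtain ⟨δ, hδ, hδu⟩ := Metric.isOpen_iff.1 hu x (hxu rfl)
  refine ⟨δ, hδ, fun y hy ζ hζ => huv (a := (y, ζ)) ⟨hδu ?_, hsv hζ⟩⟩
  rwa [Metric.mem_ball, dist_eq_norm]

/-- Localized moments of the resolvent of a symbol. -/
theorem exists_local_moments (M : MatWiener d) (w : Circle) (c : ℂ) {e : ℝ} (he : 0 < e) :
    ∃ r, e / 2 < r ∧ r < e ∧ ∃ (b : Wiener) (K : ℤ → MatWiener d), Wiener.eval w b ≠ 0 ∧
      (∀ z, Wiener.eval z b ≠ 0 → Metric.sphere c r ⊆ resolventSet ℂ (eval z M)) ∧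
      (∀ n z, eval z (K n) = Wiener.eval z b • moment c r n (eval z M)) ∧
      ∃ C, ∀ n : ℕ, ‖K n‖ ≤ C * r ^ n := by
  obtain ⟨r, hr, hre, hs⟩ := exists_sphere_subset (eval w M) c he
  have hr0 : 0 < r := by linarith
  obtain ⟨δ, hδ, hδs⟩ := exists_ball_sphere_subset hs
  have hU : {z | ‖eval z M - eval w M‖ < δ} ∈ 𝓝 w := by
    refine IsOpen.mem_nhds (isOpen_lt ?_ continuous_const) ?_
    · exact ((continuous_eval_left M).sub continuous_const).norm
    · simpa using hδ
  obtain ⟨b, b', hbw, hbb', hb', hbU⟩ := exists_wiener_bump w hU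
  -- The deformed symbol stays within `δ` of its value at `w` everywhere and equals `M` where `b ≠
  -- 0`. Thus its resolvent exists over the Wiener algebra on the whole contour, and multiplication
  -- by `b` hides the deformation.
  obtain ⟨N, hN⟩ : ∃ N : MatWiener d, ∀ z, eval z N =
      eval w M + Wiener.eval z b' • (eval z M - eval w M) :=
    ⟨const (eval w M) + scalar b' * (M - const (eval w M)), fun z => by
      rw [map_add, map_mul, map_sub, eval_const, eval_scalar, smul_mul_assoc, one_mul]⟩
  have hNs : ∀ z, Metric.sphere c r ⊆ resolventSet ℂ (eval z N) := fun z => by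
    refine hδs _ ?_
    rw [hN, add_sub_cancel_left, norm_smul]
    by_cases hz : z ∈ {z | ‖eval z M - eval w M‖ < δ}
    · exact (mul_le_of_le_one_left (norm_nonneg _) (hb' z)).trans_lt hz
    · rwa [hbU z hz, norm_zero, zero_mul]
  have hNs' : Metric.sphere c r ⊆ resolventSet ℂ N := fun ζ hζ => by
    refine isUnit_of_eval _ fun z => ?_
    rw [map_sub, AlgHom.commutes]
    exact hNs z hζ
  have hNM : ∀ z, Wiener.eval z b ≠ 0 → eval z N = eval z M := fun z hz => by
    rw [hN, hbb' z hz, one_smul, add_sub_cancel]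
  obtain ⟨C, hC⟩ := norm_moment_le hr0 hNs'
  refine ⟨r, hr, hre, b, fun n => scalar b * moment c r n N, hbw,
    fun z hz => hNM z hz ▸ hNs z, fun n z => ?_, ‖scalar (d := d) b‖ * C, fun n => ?_⟩
  · rw [map_mul, eval_scalar, smul_mul_assoc, one_mul,
      map_moment (eval z) (continuous_eval z) hr0 hNs']
    by_cases hz : Wiener.eval z b = 0
    · rw [hz]
      exact ContinuousLinearMap.ext fun v => by simp
    · rw [hNM z hz]
  · rw [mul_assoc]
    exact (norm_mul_le _ _).trans (mul_le_mul_of_nonneg_left (hC n) (norm_nonneg _))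

end MatWiener

/-! ### Relative inverses -/

section RelativeInverse

variable {E : Type*} [NormedAddCommGroup E] [NormedSpace ℂ E]

/-- Invertibility on the subspace becomes a set of identities between operators on the whole space,
where the symbol calculus is available. -/
theorem not_mem_spectrumOn_iff {T V : E →L[ℂ] E} (hV : V * V = V)
    (h : ∀ x ∈ rangeOf V, T x ∈ rangeOf V) (c : ℂ) :
    c ∉ spectrumOn T (rangeOf V) h ↔ ∃ G : E →L[ℂ] E, V * G * V = G ∧
      G * (V * (algebraMap ℂ _ c - T) * V) = V ∧ V * (algebraMap ℂ _ c - T) * V * G = V := by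
  have hVr : ∀ x ∈ rangeOf V, V x = x := by
    rintro _ ⟨y, rfl⟩
    exact DFunLike.congr_fun hV y
  have hVm : ∀ x, V x ∈ rangeOf V := fun x => ⟨x, rfl⟩
  have hN : ∀ x ∈ rangeOf V, (V * (algebraMap ℂ (E →L[ℂ] E) c - T) * V) x = c • x - T x := by
    intro x hx
    change V (c • V x - T (V x)) = _
    rw [hVr x hx, map_sub, map_smul, hVr x hx, hVr _ (h x hx)]
  have hN' : ∀ x : rangeOf V, (((algebraMap ℂ _ c - restrictTo T (rangeOf V) h) x : rangeOf V) : E) =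
      c • (x : E) - T x := fun x => rfl
  rw [spectrumOn, spectrum.notMem_iff]
  constructor
  · rintro ⟨u, hu⟩
    have h1 : ∀ x, (↑u⁻¹ : rangeOf V →L[ℂ] rangeOf V)
        ((algebraMap ℂ _ c - restrictTo T (rangeOf V) h) x) = x := fun x => by
      rw [← hu]
      exact DFunLike.congr_fun u.inv_mul x
    have h2 : ∀ x, (algebraMap ℂ _ c - restrictTo T (rangeOf V) h)
        ((↑u⁻¹ : rangeOf V →L[ℂ] rangeOf V) x) = x := fun x => by
      rw [← hu]
      exact DFunLike.congr_fun u.mul_inv x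
    let B : rangeOf V →L[ℂ] rangeOf V := ↑u⁻¹
    let G : E →L[ℂ] E := (rangeOf V).subtypeL.comp (B.comp (V.codRestrict (rangeOf V) hVm))
    have hG : ∀ x, G x = B ⟨V x, hVm x⟩ := fun x => rfl
    refine ⟨G, ContinuousLinearMap.ext fun x => ?_, ContinuousLinearMap.ext fun x => ?_,
      ContinuousLinearMap.ext fun x => ?_⟩
    · change V (G (V x)) = G x
      rw [hG, hG, hVr _ (Subtype.prop _)]
      simp only [hVr _ (hVm x)]
    · change G ((V * (algebraMap ℂ (E →L[ℂ] E) c - T) * V) x) = V x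
      have h3 : (V * (algebraMap ℂ (E →L[ℂ] E) c - T) * V) x =
          c • V x - T (V x) := by
        rw [← hN _ (hVm x)]
        change _ = (V * (algebraMap ℂ (E →L[ℂ] E) c - T)) (V (V x))
        rw [hVr _ (hVm x)]
        rfl
      rw [h3, hG]
      have h4 := congrArg (Subtype.val) (h1 ⟨V x, hVm x⟩)
      refine Eq.trans ?_ h4
      congr 2
      refine Subtype.ext ?_
      rw [hN']
      exact hVr _ (Submodule.sub_mem _ (Submodule.smul_mem _ _ (hVm x)) (h _ (hVm x)))
    · change (V * (algebraMap ℂ (E →L[ℂ] E) c - T) * V) (G x) = V x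
      rw [hG, hN _ (Subtype.prop _), ← hN', h2]
  · rintro ⟨G, hG, hGN, hNG⟩
    have hGr : ∀ x, G x ∈ rangeOf V := fun x => by
      rw [← hG]
      exact hVm _
    let B : rangeOf V →L[ℂ] rangeOf V := restrictTo G (rangeOf V) fun x _ => hGr x
    have hB : ∀ x : rangeOf V, ((B x : rangeOf V) : E) = G x := fun x => rfl
    refine isUnit_iff_exists.2 ⟨B, ContinuousLinearMap.ext fun x => Subtype.ext ?_,
      ContinuousLinearMap.ext fun x => Subtype.ext ?_⟩
    · change (((algebraMap ℂ _ c - restrictTo T (rangeOf V) h) (B x) : rangeOf V) : E) = x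
      rw [hN', hB, ← hN _ (hGr _)]
      exact (DFunLike.congr_fun hNG (x : E)).trans (hVr _ x.2)
    · change G ((algebraMap ℂ _ c - restrictTo T (rangeOf V) h) x : rangeOf V) = x
      rw [hN', ← hN _ x.2]
      exact (DFunLike.congr_fun hGN (x : E)).trans (hVr _ x.2)

/-- Iterating the relation bounds `‖Y 0‖` by `‖G‖ ^ n * ‖Y n‖ ≤ C (‖G‖ r) ^ n`, which tends to zero.
-/
theorem eq_zero_of_mul_succ_eq {R : Type*} [NormedRing R] {G : R} {Y : ℕ → R}
    (hY : ∀ n, -(G * Y (n + 1)) = Y n) {C r : ℝ} (hr : 0 ≤ r) (hC : ∀ n, ‖Y n‖ ≤ C * r ^ n)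
    (hG : ‖G‖ * r < 1) : Y 0 = 0 := by
  have h1 : ∀ n, ‖Y 0‖ ≤ ‖G‖ ^ n * ‖Y n‖ := fun n => by
    induction n with
    | zero => simp
    | succ n ih =>
      refine ih.trans ?_
      rw [pow_succ, mul_assoc]
      refine mul_le_mul_of_nonneg_left ?_ (by positivity)
      rw [← hY n, norm_neg]
      exact norm_mul_le _ _
  have h2 : Tendsto (fun n : ℕ => C * (‖G‖ * r) ^ n) atTop (𝓝 (C * 0)) :=
    (tendsto_pow_atTop_nhds_zero_of_lt_one (by positivity) hG).const_mul C
  rw [mul_zero] at h2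
  refine norm_le_zero_iff.1 (ge_of_tendsto' h2 fun n => (h1 n).trans ?_)
  rw [mul_pow, mul_left_comm]
  exact mul_le_mul_of_nonneg_left (hC n) (by positivity)

end RelativeInverse

/-! ### Moments as inverses of `c - m` modulo the Riesz projection -/

section Moments

variable {R : Type*} [NormedRing R] [NormedAlgebra ℂ R] [CompleteSpace R] {c : ℂ} {r : ℝ} {m : R}

theorem algebraMap_sub_mul_moment (hr : 0 < r) (hm : Metric.sphere c r ⊆ resolventSet ℂ m) :
    (algebraMap ℂ R c - m) * moment c r (-1) m = 1 - moment c r 0 m := by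
  have h1 := sub_mul_moment hr hm (-1)
  rw [if_pos rfl, show (-1 : ℤ) + 1 = 0 by norm_num] at h1
  rw [← neg_sub (moment c r 0 m), ← h1, ← neg_mul, neg_sub]

theorem moment_mul_algebraMap_sub (hr : 0 < r) (hm : Metric.sphere c r ⊆ resolventSet ℂ m) :
    moment c r (-1) m * (algebraMap ℂ R c - m) = 1 - moment c r 0 m := by
  rw [← algebraMap_sub_mul_moment hr hm, mul_sub, sub_mul, ← Algebra.commutes,
    (commute_moment hr hm (-1)).eq]

theorem mul_algebraMap_sub_mul_moment_mul (hr : 0 < r)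
    (hm : Metric.sphere c r ⊆ resolventSet ℂ m) (n : ℕ) (p q : R) :
    p * ((algebraMap ℂ R c - m) * moment c r n m) * q = -(p * moment c r (n + 1 : ℕ) m * q) := by
  have h1 := sub_mul_moment hr hm n
  rw [if_neg (by omega), sub_zero] at h1
  rw [← neg_sub m, neg_mul, h1, mul_neg, neg_mul]
  rfl

end Moments

/-- The contour is known to avoid the spectrum of `A(z)` only where the bump function is nonzero;
with the bump as a factor, identities become valid at every `z`. -/
theorem smul_eq_smul_of_ne {d : ℕ} {b : ℂ} {x y : Mat d} (h : b ≠ 0 → x = y) : b • x = b • y := by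
  by_cases hb : b = 0
  · rw [hb]
    exact ContinuousLinearMap.ext fun v => by simp
  · rw [h hb]

/-! ### Compressed moments in the Schur basis -/

namespace SchurData

variable {d : ℕ} {a : Circle → Mat d} (s : SchurData a) {z : Circle} {c : ℂ} {r : ℝ}

/-- The two compressions multiply to the compression of `1` minus the Riesz projection, and the
latter has no component in a block whose eigenvalues lie outside the circle. -/
theorem compress_moment_mul (hr : 0 < r) (h : Metric.sphere c r ⊆ resolventSet ℂ (a z))
    {I : Finset (Fin d)} (hI : (I : Set (Fin d)).OrdConnected)
    (hlam : ∀ l ∈ I, s.lam l z ∉ Metric.closedBall c r) :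
    s.proj I z * moment c r (-1) (a z) * s.proj I z *
      (s.proj I z * (algebraMap ℂ (Mat d) c - a z) * s.proj I z) = s.proj I z := by
  rw [Tri.proj_mul_mul_proj (s.tri_moment hr h _) ((s.tri_algebraMap z c).sub (s.tri_self z)) hI,
    moment_mul_algebraMap_sub hr h, mul_sub, sub_mul, s.proj_mul_moment_mul_proj hr h hI hlam, mul_one, s.proj_mul_proj,
    sub_zero]

theorem compress_mul_moment (hr : 0 < r) (h : Metric.sphere c r ⊆ resolventSet ℂ (a z))
    {I : Finset (Fin d)} (hI : (I : Set (Fin d)).OrdConnected)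
    (hlam : ∀ l ∈ I, s.lam l z ∉ Metric.closedBall c r) :
    s.proj I z * (algebraMap ℂ (Mat d) c - a z) * s.proj I z *
      (s.proj I z * moment c r (-1) (a z) * s.proj I z) = s.proj I z := by
  rw [Tri.proj_mul_mul_proj ((s.tri_algebraMap z c).sub (s.tri_self z)) (s.tri_moment hr h _) hI,
    algebraMap_sub_mul_moment hr h, mul_sub, sub_mul, s.proj_mul_moment_mul_proj hr h hI hlam, mul_one, s.proj_mul_proj,
    sub_zero]

/-- The eigenvalues of the block are not restricted here: this is the recursion for the case in
which the circle does enclose one of them. -/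
theorem compress_mul_moment_succ (hr : 0 < r) (h : Metric.sphere c r ⊆ resolventSet ℂ (a z))
    {I : Finset (Fin d)} (hI : (I : Set (Fin d)).OrdConnected) (n : ℕ) :
    s.proj I z * (algebraMap ℂ (Mat d) c - a z) * s.proj I z *
      (s.proj I z * moment c r n (a z) * s.proj I z) =
        -(s.proj I z * moment c r (n + 1 : ℕ) (a z) * s.proj I z) := by
  rw [Tri.proj_mul_mul_proj ((s.tri_algebraMap z c).sub (s.tri_self z)) (s.tri_moment hr h _) hI]
  exact mul_algebraMap_sub_mul_moment_mul hr h n _ _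

end SchurData

theorem exists_angle (z : Circle) : ∃ θ ∈ Ico 0 (2 * Real.pi), Circle.exp θ = z := by
  refine ⟨toIcoMod Real.two_pi_pos 0 (Complex.arg z), ?_, ?_⟩
  · simpa using toIcoMod_mem_Ico Real.two_pi_pos 0 (Complex.arg z)
  · rw [toIcoMod, zsmul_eq_mul, Circle.exp_eq_exp.2 ⟨-toIcoDiv Real.two_pi_pos 0 (Complex.arg z), ?_⟩,
      Circle.exp_arg]
    push_cast
    ring

theorem AlgHom.exists_norm_le {R S : Type*} [NormedRing R] [NormedAlgebra ℂ R] [NormedRing S]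
    [NormedAlgebra ℂ S] (f : R →ₐ[ℂ] S) (hf : Continuous f) : ∃ C, 0 ≤ C ∧ ∀ x, ‖f x‖ ≤ C * ‖x‖ := by
  let L : R →L[ℂ] S := ⟨f.toLinearMap, hf⟩
  exact ⟨‖L‖, norm_nonneg L, L.le_opNorm⟩

/-! ### Spectra of compressions -/

section Core

variable {d : ℕ} {p : ℝ≥0∞} [Fact (1 ≤ p)] {X : Submodule ℂ (SeqLp d p)} [hX : Admissible X]

/-- A symbol of the zero operator vanishes almost everywhere, whereas a right neighbourhood of `t`
has positive measure. -/
theorem HasSymbol.false_of_eventually_ne {F : Circle → Mat d} (hF : HasSymbol (0 : X →L[ℂ] X) F)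
    {t : ℝ} (ht : t ∈ Ico 0 (2 * Real.pi)) (h : ∀ᶠ θ in 𝓝[>] t, F (Circle.exp θ) ≠ 0) : False := by
  have h2 : ∀ᶠ θ in 𝓝[>] t, θ < 2 * Real.pi :=
    nhdsWithin_le_nhds (Iio_mem_nhds ht.2)
  obtain ⟨u, hu, hus⟩ := mem_nhdsGT_iff_exists_Ioo_subset.1 (h.and h2)
  have hsub : Ioo t u ⊆ Ioc 0 (2 * Real.pi) := fun θ hθ => ⟨ht.1.trans_lt hθ.1, (hus hθ).2.le⟩
  have h3 := ae_restrict_of_ae_restrict_of_subset hsub hF.ae_eq_zero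
  have h4 : volume.restrict (Ioo t u) ≠ 0 := by
    rw [Ne, Measure.restrict_eq_zero, Real.volume_Ioo, ENNReal.ofReal_eq_zero, not_le, sub_pos]
    exact hu
  have : (ae (volume.restrict (Ioo t u))).NeBot := ae_neBot.2 h4
  obtain ⟨θ, hθ, hθ'⟩ := (h3.and (ae_restrict_mem measurableSet_Ioo)).exists
  exact (hus hθ').1 hθ

variable {a : Circle → Mat d} (s : SchurData a) {M : MatWiener d} (ha : ∀ z, MatWiener.eval z M = a z)
  {V : X →L[ℂ] X} {I : Circle → Finset (Fin d)}

theorem HasSymbol.compress (hV : HasSymbol V fun z => s.proj (I z) z) {T : X →L[ℂ] X}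
    {F : Circle → Mat d} (hT : HasSymbol T F) :
    HasSymbol (V * T * V) fun z => s.proj (I z) z * F z * s.proj (I z) z := (hV.mul hT).mul hV

theorem HasSymbol.isIdempotent (hV : HasSymbol V fun z => s.proj (I z) z) : V * V = V :=
  (hV.mul hV).eq hV fun z => s.proj_mul_proj z (I z)

include ha in
theorem hasSymbol_algebraMap_sub_act (c : ℂ) :
    HasSymbol (algebraMap ℂ (X →L[ℂ] X) c - act X M) fun z => algebraMap ℂ (Mat d) c - a z := by
  refine (((HasSymbol.one X).smul c).sub (HasSymbol.act X M)).congr fun z => ?_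
  rw [ha, Algebra.algebraMap_eq_smul_one]

theorem HasSymbol.commute_act_scalar {T : X →L[ℂ] X} {F : Circle → Mat d} (hT : HasSymbol T F)
    (b : Wiener) : BlockConv.act X (MatWiener.scalar b) * T = T * BlockConv.act X (MatWiener.scalar b) := by
  refine ((HasSymbol.act X _).mul hT).eq (hT.mul (HasSymbol.act X _)) fun z => ?_
  rw [MatWiener.eval_scalar, smul_mul_assoc, mul_smul_comm, one_mul, mul_one]

/-- Elements of the Wiener algebra up to which an operator is invertible on the range of a
projection form an ideal. -/
def relativeInverseIdeal (V N : X →L[ℂ] X) {F H : Circle → Mat d} (hV : HasSymbol V F)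
    (hN : HasSymbol N H) : Ideal Wiener where
  carrier := {b | ∃ G : X →L[ℂ] X, V * G * V = G ∧
    G * N = act X (MatWiener.scalar b) * V ∧ N * G = act X (MatWiener.scalar b) * V}
  zero_mem' := ⟨0, by rw [mul_zero, zero_mul], by rw [map_zero, map_zero, zero_mul, zero_mul],
    by rw [map_zero, map_zero, zero_mul, mul_zero]⟩
  add_mem' := by
    rintro b b' ⟨G, h1, h2, h3⟩ ⟨G', h1', h2', h3'⟩
    exact ⟨G + G', by rw [mul_add, add_mul, h1, h1'],
      by rw [add_mul, h2, h2', map_add, map_add, add_mul],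
      by rw [mul_add, h3, h3', map_add, map_add, add_mul]⟩
  smul_mem' := by
    rintro b b' ⟨G, h1, h2, h3⟩
    refine ⟨act X (MatWiener.scalar b) * G, ?_, ?_, ?_⟩
    · rw [← mul_assoc, ← hV.commute_act_scalar, mul_assoc, mul_assoc, ← mul_assoc V, h1]
    · rw [mul_assoc, h2, smul_eq_mul, map_mul, map_mul, mul_assoc]
    · rw [← mul_assoc, ← hN.commute_act_scalar, mul_assoc, h3, smul_eq_mul, map_mul, map_mul,
        mul_assoc]

include ha in
/-- Outside of the closure of the set of eigenvalues in a diagonal block, the compression of a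
convolution operator to this block is invertible. -/
theorem exists_relative_inverse (hV : HasSymbol V fun z => s.proj (I z) z)
    (hI : ∀ z, (I z : Set (Fin d)).OrdConnected) {c : ℂ}
    (hc : c ∉ closure {x | ∃ z, ∃ l ∈ I z, x = s.lam l z}) :
    ∃ G : X →L[ℂ] X, V * G * V = G ∧ G * (V * (algebraMap ℂ _ c - act X M) * V) = V ∧
      V * (algebraMap ℂ _ c - act X M) * V * G = V := by
  have hN := HasSymbol.compress s hV (hasSymbol_algebraMap_sub_act (X := X) ha c)
  rw [Metric.mem_closure_iff] at hc
  push Not at hc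
  obtain ⟨e, he, hce⟩ := hc
  -- The ideal glues the local inverses without a partition of unity: it suffices to find, for each
  -- `w`, a member that does not vanish at `w`.
  have hone : (1 : Wiener) ∈ relativeInverseIdeal V _ hV hN := by
    refine Wiener.one_mem_of_forall_exists _ fun w => ?_
    obtain ⟨r, hr, hre, b, K, hb, hs, hK, -⟩ := MatWiener.exists_local_moments M w c he
    have hr0 : 0 < r := by linarith
    have hlam : ∀ z, ∀ l ∈ I z, s.lam l z ∉ Metric.closedBall c r := fun z l hl h => by
      have := hce _ ⟨z, l, hl, rfl⟩
      rw [Metric.mem_closedBall, dist_comm] at h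
      linarith
    have hG := HasSymbol.compress s hV (HasSymbol.act X (K (-1)))
    have hbV := (HasSymbol.act X (MatWiener.scalar b)).mul hV
    have hs' : ∀ z, Wiener.eval z b ≠ 0 → Metric.sphere c r ⊆ resolventSet ℂ (a z) :=
      fun z hz => ha z ▸ hs z hz
    refine ⟨b, ⟨V * act X (K (-1)) * V, ?_, (hG.mul hN).eq hbV fun z => ?_,
      (hN.mul hG).eq hbV fun z => ?_⟩, hb⟩
    · rw [mul_assoc, mul_assoc, mul_assoc, HasSymbol.isIdempotent s hV, ← mul_assoc, ← mul_assoc,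
        HasSymbol.isIdempotent s hV]
    · rw [hK, MatWiener.eval_scalar, mul_smul_comm, smul_mul_assoc, smul_mul_assoc, smul_mul_assoc,
        one_mul, ha]
      exact smul_eq_smul_of_ne fun hz =>
        s.compress_moment_mul hr0 (hs' z hz) (hI z) (hlam z)
    · rw [hK, MatWiener.eval_scalar, mul_smul_comm, smul_mul_assoc, smul_mul_assoc, mul_smul_comm,
        one_mul, ha]
      exact smul_eq_smul_of_ne fun hz =>
        s.compress_mul_moment hr0 (hs' z hz) (hI z) (hlam z)
  obtain ⟨G, h1, h2, h3⟩ := hone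
  rw [map_one, map_one, one_mul] at h2 h3
  exact ⟨G, h1, h2, h3⟩

include ha in
/-- At points of the closure of the set of eigenvalues in a diagonal block, the compression of a
convolution operator to this block has no left inverse. -/
theorem not_mem_closure_of_left_inverse (hV : HasSymbol V fun z => s.proj (I z) z)
    (hI : ∀ z, (I z : Set (Fin d)).OrdConnected)
    (hright : ∀ t ∈ Ico 0 (2 * Real.pi), ∀ᶠ θ in 𝓝[>] t, I (Circle.exp θ) = I (Circle.exp t))
    {c : ℂ} {G : X →L[ℂ] X} (hG : G * (V * (algebraMap ℂ _ c - act X M) * V) = V) :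
    c ∉ closure {x | ∃ z, ∃ l ∈ I z, x = s.lam l z} := by
  intro hc
  have hN := HasSymbol.compress s hV (hasSymbol_algebraMap_sub_act (X := X) ha c)
  -- With `e = (‖G‖ + 1)⁻¹`, a radius `r < e` gives `‖G‖ r < 1`, while `r > e / 2` makes the circle
  -- enclose an eigenvalue at distance less than `e / 2` from `c`.
  have he : 0 < (‖G‖ + 1)⁻¹ := by positivity
  obtain ⟨_, ⟨w, l, hl, rfl⟩, hdist⟩ := Metric.mem_closure_iff.1 hc _ (half_pos he)
  obtain ⟨t, ht, rfl⟩ := exists_angle w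
  obtain ⟨r, hr, hre, b, K, hb, hs, hK, C, hC⟩ :=
    MatWiener.exists_local_moments M (Circle.exp t) c he
  have hr0 : 0 < r := by linarith
  have hs' : ∀ z, Wiener.eval z b ≠ 0 → Metric.sphere c r ⊆ resolventSet ℂ (a z) :=
    fun z hz => ha z ▸ hs z hz
  obtain ⟨Y, hYdef⟩ : ∃ Y : ℕ → X →L[ℂ] X, ∀ n, Y n = V * act X (K n) * V := ⟨_, fun _ => rfl⟩
  have hY : ∀ n, HasSymbol (Y n) fun z =>
      Wiener.eval z b • (s.proj (I z) z * moment c r n (a z) * s.proj (I z) z) := fun n => by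
    rw [hYdef]
    refine (HasSymbol.compress s hV (HasSymbol.act X (K n))).congr fun z => ?_
    rw [hK, mul_smul_comm, smul_mul_assoc, ha]
  have hVY : ∀ n, V * Y n = Y n := fun n => by
    rw [hYdef, ← mul_assoc, ← mul_assoc, HasSymbol.isIdempotent s hV]
  have hNY : ∀ n, V * (algebraMap ℂ _ c - act X M) * V * Y n = (-1 : ℂ) • Y (n + 1) := fun n => by
    refine (hN.mul (hY n)).eq ((hY (n + 1)).smul (-1)) fun z => ?_
    rw [mul_smul_comm, smul_comm (-1 : ℂ)]
    refine smul_eq_smul_of_ne fun hz => ?_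
    rw [s.compress_mul_moment_succ hr0 (hs' z hz) (hI z)]
    exact ContinuousLinearMap.ext fun v => by simp
  -- Applying the left inverse to the relation `hNY` reverses it and expresses each moment through
  -- the next one.
  have hrec : ∀ n, -(G * Y (n + 1)) = Y n := fun n => by
    have h1 : G * (V * (algebraMap ℂ _ c - act X M) * V) * Y n = Y n := by rw [hG, hVY]
    rw [mul_assoc, hNY] at h1
    rw [← h1]
    exact ContinuousLinearMap.ext fun v => by simp
  have hbound : ∃ C, ∀ n, ‖Y n‖ ≤ C * r ^ n := by
    obtain ⟨L, hL0, hL⟩ := AlgHom.exists_norm_le (R := MatWiener d) (S := X →L[ℂ] X) (act X)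
      (continuous_act X)
    refine ⟨‖V‖ * (L * C) * ‖V‖, fun n => ?_⟩
    have h1 : ‖act X (K n)‖ ≤ L * (C * r ^ n) :=
      (hL (K n)).trans (mul_le_mul_of_nonneg_left (hC n) hL0)
    rw [hYdef]
    calc ‖V * act X (K n) * V‖ ≤ ‖V‖ * ‖act X (K n)‖ * ‖V‖ :=
          (ContinuousLinearMap.opNorm_comp_le _ _).trans
            (mul_le_mul_of_nonneg_right (ContinuousLinearMap.opNorm_comp_le _ _) (norm_nonneg V))
      _ ≤ ‖V‖ * (L * (C * r ^ n)) * ‖V‖ := by gcongr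
      _ = ‖V‖ * (L * C) * ‖V‖ * r ^ n := by ring
  obtain ⟨C', hC'⟩ := hbound
  have hGr : ‖G‖ * r < 1 := by
    have h1 : (‖G‖ + 1) * r < (‖G‖ + 1) * (‖G‖ + 1)⁻¹ :=
      mul_lt_mul_of_pos_left hre (by positivity)
    rw [mul_inv_cancel₀ (by positivity)] at h1
    linarith
  have h0 := hY 0
  have hY0 : Y 0 = 0 := eq_zero_of_mul_succ_eq (R := X →L[ℂ] X) (G := G) hrec hr0.le hC' hGr
  rw [hY0] at h0
  refine h0.false_of_eventually_ne ht ?_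
  have h1 : ∀ᶠ θ in 𝓝[>] t, Wiener.eval (Circle.exp θ) b ≠ 0 :=
    nhdsWithin_le_nhds ((((Wiener.continuous_eval b).comp Circle.exp.continuous).continuousAt
      (x := t)).eventually_ne hb)
  -- The eigenvalue is continuous only on `[0, 2π)`, so it stays inside the circle only to the right
  -- of `t`; this also covers `t = 0`.
  have h2 : ∀ᶠ θ in 𝓝[>] t, s.lam l (Circle.exp θ) ∈ Metric.ball c r := by
    have h3 : 𝓝[>] t ≤ 𝓝[Ico 0 (2 * Real.pi)] t :=
      nhdsWithin_le_iff.2 (mem_of_superset (Ioo_mem_nhdsGT ht.2) fun θ hθ =>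
        ⟨ht.1.trans hθ.1.le, hθ.2⟩)
    refine ((s.continuousOn_lam l t ht).mono_left h3).eventually
      (Metric.isOpen_ball.mem_nhds ?_)
    rw [Metric.mem_ball, dist_comm]
    linarith
  filter_upwards [h1, h2, hright t ht] with θ h1 h2 h3 h4
  have h5 := congrArg (s.mc (Circle.exp θ) l l) h4
  rw [map_zero, map_smul, s.mc_mul_proj, s.mc_proj_mul, h3, if_pos hl, if_pos hl, Nat.cast_zero,
    s.mc_moment_self hr0 (hs' _ h1) h2, smul_eq_mul, mul_one] at h5
  exact h1 h5

end Core

/-! ### Spectra on the ranges of projections and of the diagonal part -/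

section Spectra

variable {d : ℕ} {p : ℝ≥0∞} [Fact (1 ≤ p)] {X : Submodule ℂ (SeqLp d p)} [hX : Admissible X]
  {a : Circle → Mat d} (s : SchurData a) {M : MatWiener d} (ha : ∀ z, MatWiener.eval z M = a z)
  {V : X →L[ℂ] X} {I : Circle → Finset (Fin d)}

include ha in
-- `T` enters only through `V T V`, so the result serves both the restriction of `A` to an invariant
-- range and the operator `(1 - P) A` on the complementary range.
theorem spectrumOn_eq (hV : HasSymbol V fun z => s.proj (I z) z)
    (hI : ∀ z, (I z : Set (Fin d)).OrdConnected)
    (hright : ∀ t ∈ Ico 0 (2 * Real.pi), ∀ᶠ θ in 𝓝[>] t, I (Circle.exp θ) = I (Circle.exp t))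
    {T : X →L[ℂ] X} (h : ∀ x ∈ rangeOf V, T x ∈ rangeOf V) (hT : V * T * V = V * act X M * V) :
    spectrumOn T (rangeOf V) h = closure {x | ∃ z, ∃ l ∈ I z, x = s.lam l z} := by
  have hN : ∀ c : ℂ, V * (algebraMap ℂ _ c - T) * V = V * (algebraMap ℂ _ c - act X M) * V :=
    fun c => by rw [mul_sub, sub_mul, hT, mul_sub, sub_mul]
  ext c
  rw [← not_iff_not, not_mem_spectrumOn_iff (HasSymbol.isIdempotent s hV) h]
  constructor
  · rintro ⟨G, -, hG, -⟩
    rw [hN] at hG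
    exact not_mem_closure_of_left_inverse s ha hV hI hright hG
  · intro hc
    rw [hN]
    exact exists_relative_inverse s ha hV hI hc

theorem HasSymbol.one_proj_univ : HasSymbol (1 : X →L[ℂ] X) fun z => s.proj Finset.univ z :=
  (HasSymbol.one X).congr fun z => (s.proj_univ z).symm

include ha in
theorem spectrum_act_eq :
    spectrum ℂ (act X M) = closure {x | ∃ z, ∃ l ∈ Finset.univ, x = s.lam l z} := by
  have hI : ∀ z : Circle, ((Finset.univ : Finset (Fin d)) : Set (Fin d)).OrdConnected := fun _ => by
    rw [Finset.coe_univ]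
    exact ordConnected_univ
  have hV := HasSymbol.one_proj_univ (X := X) s
  ext c
  rw [← not_iff_not, spectrum.notMem_iff]
  constructor
  · rintro ⟨u, hu⟩
    refine not_mem_closure_of_left_inverse (G := ↑u⁻¹) s ha hV hI
      (fun t _ => Eventually.of_forall fun _ => rfl) ?_
    rw [one_mul, mul_one, ← hu, Units.inv_mul]
  · intro hc
    obtain ⟨G, -, h1, h2⟩ := exists_relative_inverse s ha hV hI hc
    rw [one_mul, mul_one] at h1 h2
    exact isUnit_iff_exists.2 ⟨G, h2, h1⟩

theorem proj_singleton (k : Fin d) (z : Circle) : s.proj {k} z = s.deltaP k z := by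
  rw [SchurData.proj, Finset.sum_singleton]

theorem SchurData.proj_singleton_mul_mul (k : Fin d) (z : Circle) :
    s.proj {k} z * a z * s.proj {k} z = s.lam k z • s.deltaP k z := by
  refine s.mc_ext z fun j l => ?_
  rw [s.mc_mul_proj, s.mc_proj_mul, map_smul, s.mc_deltaP]
  by_cases h1 : l = k
  · subst h1
    by_cases h2 : j = l
    · subst h2
      simp [s.mc_self_self]
    · simp [h2]
  · by_cases h2 : j = l
    · subst h2
      simp [h1]
    · simp [h1, h2]

include ha in
/-- The block diagonal part of a convolution operator has the same spectrum. -/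
theorem exists_diag {D : Fin d → X →L[ℂ] X} (hD : ∀ k, HasSymbol (D k) (s.deltaP k)) :
    ∃ T : X →L[ℂ] X, HasSymbol T s.diag ∧ spectrum ℂ (act X M) = spectrum ℂ T := by
  have hD' : ∀ k, HasSymbol (D k) fun z => s.proj {k} z := fun k =>
    (hD k).congr fun z => (proj_singleton s k z).symm
  have hDD : ∀ k, D k * D k = D k := fun k => HasSymbol.isIdempotent s (hD' k)
  have hDjk : ∀ j k, j ≠ k → D j * D k = 0 := fun j k hjk => by
    have h0 := HasSymbol.act X (0 : MatWiener d)
    rw [map_zero] at h0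
    refine ((hD j).mul (hD k)).eq h0 fun z => s.mc_ext z fun i l => ?_
    rw [← proj_singleton, s.mc_proj_mul, s.mc_deltaP, map_zero, map_zero]
    split_ifs <;> simp_all
  have hsum : ∑ k, D k = 1 := by
    refine (HasSymbol.sum Finset.univ fun k _ => hD k).eq (HasSymbol.one_proj_univ s) fun z => rfl
  have hI : ∀ k : Fin d, ∀ z : Circle, ((({k} : Finset (Fin d))) : Set (Fin d)).OrdConnected :=
    fun k _ => by
      rw [Finset.coe_singleton]
      exact ordConnected_singleton
  -- The operator `A_0` is the sum of the diagonal blocks of `A`, because the compression of `A(z)`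
  -- to `φ^{(k)}(z)` is `λ_k(z) ΔP_k(z)`.
  have hT : HasSymbol (∑ k, D k * act X M * D k) s.diag := by
    refine (HasSymbol.sum Finset.univ fun k _ =>
      HasSymbol.compress s (hD' k) (HasSymbol.act X M)).congr fun z => ?_
    rw [SchurData.diag]
    exact Finset.sum_congr rfl fun k _ => by rw [ha, s.proj_singleton_mul_mul]
  have hTD : ∀ k, (∑ j, D j * act X M * D j) * D k = D k * act X M * D k := fun k => by
    rw [Finset.sum_mul, Finset.sum_eq_single k]
    · rw [mul_assoc, hDD]
    · intro j _ hj
      rw [mul_assoc, hDjk j k hj, mul_zero]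
    · simp
  have hDT : ∀ k, D k * (∑ j, D j * act X M * D j) = D k * act X M * D k := fun k => by
    rw [Finset.mul_sum, Finset.sum_eq_single k]
    · rw [← mul_assoc, ← mul_assoc, hDD]
    · intro j _ hj
      rw [← mul_assoc, ← mul_assoc, hDjk k j hj.symm, zero_mul, zero_mul]
    · simp
  refine ⟨_, hT, ?_⟩
  obtain ⟨T, hTdef⟩ : ∃ T : X →L[ℂ] X, T = ∑ j, D j * act X M * D j := ⟨_, rfl⟩
  rw [← hTdef] at hTD hDT ⊢
  have hcomm : ∀ (c : ℂ) (k : Fin d), D k * algebraMap ℂ (X →L[ℂ] X) c =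
      algebraMap ℂ (X →L[ℂ] X) c * D k := fun c k => (Algebra.commutes c (D k)).symm
  have hcT : ∀ (c : ℂ) k, (algebraMap ℂ _ c - T) * D k =
      D k * (algebraMap ℂ _ c - act X M) * D k := fun c k => by
    rw [sub_mul, hTD, mul_sub, sub_mul, hcomm, mul_assoc _ (D k), hDD]
  have hcT' : ∀ (c : ℂ) k, D k * (algebraMap ℂ _ c - T) =
      D k * (algebraMap ℂ _ c - act X M) * D k := fun c k => by
    rw [mul_sub, hDT, mul_sub, sub_mul, hcomm, mul_assoc _ (D k), hDD]
  ext c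
  rw [spectrum_act_eq s ha, ← not_iff_not, spectrum.notMem_iff]
  have hcl : c ∈ closure {x | ∃ z, ∃ l ∈ (Finset.univ : Finset (Fin d)), x = s.lam l z} ↔
      ∃ k, c ∈ closure {x | ∃ z, ∃ l ∈ ({k} : Finset (Fin d)), x = s.lam l z} := by
    rw [← mem_iUnion, ← closure_iUnion_of_finite]
    congr! 2
    ext x
    simp only [Finset.mem_univ, true_and, Finset.mem_singleton, mem_iUnion, mem_ofPred_eq]
    constructor
    · rintro ⟨z, l, h⟩
      exact ⟨l, z, l, rfl, h⟩
    · rintro ⟨l, z, _, _, h⟩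
      exact ⟨z, _, h⟩
  rw [hcl, not_exists]
  constructor
  · intro h
    choose G hG hGN hNG using fun k => exists_relative_inverse s ha (hD' k) (hI k) (h k)
    have hDG : ∀ k, D k * G k = G k := fun k => by
      rw [← hG k, ← mul_assoc, ← mul_assoc, hDD]
    have hGD : ∀ k, G k * D k = G k := fun k => by
      rw [← hG k, mul_assoc, hDD]
    refine isUnit_iff_exists.2 ⟨∑ k, G k, ?_, ?_⟩
    · rw [Finset.mul_sum, ← hsum]
      refine Finset.sum_congr rfl fun k _ => ?_
      rw [← hDG k, ← mul_assoc, hcT, hNG]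
    · rw [Finset.sum_mul, ← hsum]
      refine Finset.sum_congr rfl fun k _ => ?_
      rw [← hGD k, mul_assoc, hcT', hGN]
  -- An inverse of `c - T` is a left inverse for each block separately, because `T` acts as that
  -- block on the range of `D k`.
  · rintro ⟨u, hu⟩ k
    refine not_mem_closure_of_left_inverse (G := ↑u⁻¹) s ha (hD' k) (hI k)
      (fun t _ => Eventually.of_forall fun _ => rfl) ?_
    rw [← hcT, ← hu, ← mul_assoc, Units.inv_mul, one_mul]

end Spectra

/-! ### The projections of the Schur triangularization -/

namespace SchurData

variable {d : ℕ} {a : Circle → Mat d} (s : SchurData a)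

theorem bddMeas_phi (k i : Fin d) : BddMeas fun z => s.phi k z i := by
  refine ⟨?_, 1, fun z => ?_⟩
  · exact (EuclideanSpace.proj (𝕜 := ℂ) i).continuous.measurable.comp (s.measurable_phi k)
  · rw [← (s.orthonormal z).norm_eq_one k]
    exact PiLp.norm_apply_le _ i

theorem bddMeasMat_deltaP (k : Fin d) : BddMeasMat (s.deltaP k) := fun i j => by
  have h : (fun z => entry i j (s.deltaP k z)) =
      fun z => (starRingEnd ℂ) (s.phi k z j) * s.phi k z i := funext fun z => by
    rw [entry_apply, deltaP]
    simp [EuclideanSpace.inner_single_right]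
  rw [h]
  exact (s.bddMeas_phi k j).conj.mul (s.bddMeas_phi k i)

theorem mem_exp_image_Ico {t θ : ℝ} (ht : t ≤ 2 * Real.pi) (hθ : θ ∈ Ico 0 (2 * Real.pi)) :
    Circle.exp θ ∈ Circle.exp '' Ico 0 t ↔ θ < t := by
  constructor
  · rintro ⟨τ, hτ, h⟩
    obtain ⟨m, hm⟩ := Circle.exp_eq_exp.1 h
    have h1 : (m : ℝ) * (2 * Real.pi) < 1 * (2 * Real.pi) := by
      have := hτ.2; have := hθ.1; linarith
    have h2 : (-1 : ℝ) * (2 * Real.pi) < m * (2 * Real.pi) := by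
      have := hτ.1; have := hθ.2; linarith
    have h3 := lt_of_mul_lt_mul_right h1 Real.two_pi_pos.le
    have h4 := lt_of_mul_lt_mul_right h2 Real.two_pi_pos.le
    have h5 : m = 0 := by
      have : m < 1 := by exact_mod_cast h3
      have : -1 < m := by exact_mod_cast h4
      omega
    rw [h5] at hm
    have := hτ.2
    simp at hm
    linarith
  · exact fun h => ⟨θ, ⟨hθ.1, h⟩, rfl⟩

open Classical in
/-- The indices of the Schur vectors that span the range of `projNu`. -/
def below (k : Fin d) (t : ℝ) (z : Circle) : Finset (Fin d) :=
  {l | l < k ∨ l = k ∧ z ∈ Circle.exp '' Ico 0 t}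

theorem mem_below {k : Fin d} {t : ℝ} {z : Circle} {l : Fin d} :
    l ∈ below k t z ↔ l < k ∨ l = k ∧ z ∈ Circle.exp '' Ico 0 t := by
  simp [below]

theorem mem_below_exp {k : Fin d} {t θ : ℝ} (ht : t ≤ 2 * Real.pi) (hθ : θ ∈ Ico 0 (2 * Real.pi))
    {l : Fin d} : l ∈ below k t (Circle.exp θ) ↔ l < k ∨ l = k ∧ θ < t := by
  rw [mem_below, mem_exp_image_Ico ht hθ]

theorem projNu_eq (k : Fin d) (t : ℝ) (z : Circle) : s.projNu k t z = s.proj (below k t z) z := by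
  refine s.mc_ext z fun j l => ?_
  rw [projNu, map_add, mc_proj]
  have hm := mem_below (k := k) (t := t) (z := z) (l := j)
  have h1 := s.mc_proj z (Finset.Iio k) j l
  rw [proj] at h1
  rw [h1]
  by_cases hz : z ∈ Circle.exp '' Ico 0 t
  · rw [indicator_of_mem hz, mc_deltaP]
    by_cases hj : j = l <;> by_cases h2 : j < k <;> by_cases h3 : j = k <;> simp_all
  · rw [indicator_of_notMem hz, map_zero]
    by_cases hj : j = l <;> by_cases h2 : j < k <;> simp_all

theorem le_of_mem_below {k : Fin d} {t : ℝ} {z : Circle} {j l : Fin d} (h : l ∈ below k t z)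
    (hjl : j ≤ l) : j ∈ below k t z := by
  rw [mem_below] at h ⊢
  rcases h with h | ⟨rfl, h⟩
  · exact Or.inl (hjl.trans_lt h)
  · exact hjl.lt_or_eq.imp_right fun h' => ⟨h', h⟩

theorem ordConnected_below (k : Fin d) (t : ℝ) (z : Circle) :
    (below k t z : Set (Fin d)).OrdConnected :=
  ⟨fun _ _ _ hy _ hx => le_of_mem_below hy hx.2⟩

theorem ordConnected_compl_below (k : Fin d) (t : ℝ) (z : Circle) :
    (((below k t z)ᶜ : Finset (Fin d)) : Set (Fin d)).OrdConnected :=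
  ⟨fun j hj l _ i hi => by
    rw [Finset.mem_coe, Finset.mem_compl] at hj ⊢
    exact fun h => hj (le_of_mem_below h hi.1)⟩

/-- The arc is half-open, `0 ≤ θ < t`, so membership in it is locally constant from the right. This
matches the right continuity of the eigenvalues. -/
theorem eventually_below_eq (k : Fin d) {t : ℝ} (ht : t ≤ 2 * Real.pi) {τ : ℝ}
    (hτ : τ ∈ Ico 0 (2 * Real.pi)) :
    ∀ᶠ θ in 𝓝[>] τ, below k t (Circle.exp θ) = below k t (Circle.exp τ) := by
  have h1 : ∀ᶠ θ in 𝓝[>] τ, θ ∈ Ioo τ (2 * Real.pi) := Ioo_mem_nhdsGT hτ.2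
  have h2 : ∀ᶠ θ in 𝓝[>] τ, (θ < t ↔ τ < t) := by
    by_cases h : τ < t
    · filter_upwards [Ioo_mem_nhdsGT h] with θ hθ
      exact iff_of_true hθ.2 h
    · filter_upwards [h1] with θ hθ
      exact iff_of_false (fun h' => h (hθ.1.trans h')) h
  filter_upwards [h1, h2] with θ hθ hθ'
  ext l
  rw [mem_below_exp ht ⟨hτ.1.trans hθ.1.le, hθ.2⟩, mem_below_exp ht hτ, hθ']

theorem bddMeasMat_projNu (k : Fin d) (t : ℝ) : BddMeasMat (s.projNu k t) := fun i j => by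
  -- In terms of the angle, the arc is a countable union of translates of `[0, t)` by multiples of
  -- `2π`.
  have hS : MeasurableSet (Circle.exp ⁻¹' (Circle.exp '' Ico 0 t)) := by
    have : Circle.exp ⁻¹' (Circle.exp '' Ico 0 t) =
        ⋃ m : ℤ, (fun θ : ℝ => θ - m * (2 * Real.pi)) ⁻¹' Ico 0 t := by
      ext θ
      simp only [mem_preimage, mem_image, mem_iUnion]
      constructor
      · rintro ⟨τ, hτ, h⟩
        obtain ⟨m, rfl⟩ := Circle.exp_eq_exp.1 h
        refine ⟨-m, ?_⟩
        convert hτ using 1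
        push_cast
        ring
      · rintro ⟨m, hm⟩
        exact ⟨_, hm, Circle.exp_eq_exp.2 ⟨-m, by push_cast; ring⟩⟩
    rw [this]
    exact MeasurableSet.iUnion fun m => measurableSet_Ico.preimage (by fun_prop)
  have hind : BddMeas ((Circle.exp '' Ico 0 t).indicator fun _ => (1 : ℂ)) := by
    refine ⟨?_, 1, fun z => ?_⟩
    · exact measurable_const.indicator hS
    · by_cases hz : z ∈ Circle.exp '' Ico 0 t
      · rw [indicator_of_mem hz, norm_one]
      · rw [indicator_of_notMem hz, norm_zero]; exact zero_le_one
  have h : (fun z => entry i j (s.projNu k t z)) =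
      fun z => ∑ l ∈ Finset.Iio k, entry i j (s.deltaP l z) +
        (Circle.exp '' Ico 0 t).indicator (fun _ => (1 : ℂ)) z * entry i j (s.deltaP k z) :=
    funext fun z => by
      rw [projNu, map_add, map_sum]
      congr 1
      by_cases hz : z ∈ Circle.exp '' Ico 0 t
      · rw [indicator_of_mem hz, indicator_of_mem hz, one_mul]
      · rw [indicator_of_notMem hz, indicator_of_notMem hz, zero_mul, map_zero]
  rw [h]
  exact (BddMeas.sum _ fun l _ => s.bddMeasMat_deltaP l i j).add
    (hind.mul (s.bddMeasMat_deltaP k i j))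

theorem setOf_below_eq (k : Fin d) {t : ℝ} (ht : t ≤ 2 * Real.pi) :
    {x | ∃ z, ∃ l ∈ below k t z, x = s.lam l z} = s.preceding k t := by
  ext x
  constructor
  · rintro ⟨z, l, hl, rfl⟩
    obtain ⟨θ, hθ, rfl⟩ := exists_angle z
    exact ⟨l, θ, hθ.1, hθ.2, (mem_below_exp ht hθ).1 hl, rfl⟩
  · rintro ⟨l, θ, h1, h2, h3, rfl⟩
    exact ⟨_, l, (mem_below_exp ht ⟨h1, h2⟩).2 h3, rfl⟩

/-- The complementary index set includes the parameter `θ = t`, which the points following `ν`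
exclude. For `t < 2π` that value is a limit of `λ_k` from the right, so the closures agree. -/
theorem closure_setOf_compl_below_eq (k : Fin d) {t : ℝ} (ht : t ≤ 2 * Real.pi) :
    closure {x | ∃ z, ∃ l ∈ (below k t z)ᶜ, x = s.lam l z} = closure (s.following k t) := by
  refine Subset.antisymm (closure_minimal ?_ isClosed_closure) (closure_mono ?_)
  · rintro _ ⟨z, l, hl, rfl⟩
    obtain ⟨θ, hθ, rfl⟩ := exists_angle z
    rw [Finset.mem_compl, mem_below_exp ht hθ, not_or, not_lt] at hl
    rcases hl.1.lt_or_eq with h | h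
    · exact subset_closure ⟨l, θ, hθ.1, hθ.2, Or.inl h, rfl⟩
    · have h1 : t ≤ θ := not_lt.1 fun h' => hl.2 ⟨h.symm, h'⟩
      have h2 : 𝓝[>] θ ≤ 𝓝[Ico 0 (2 * Real.pi)] θ :=
        nhdsWithin_le_iff.2 (mem_of_superset (Ioo_mem_nhdsGT hθ.2) fun τ hτ =>
          ⟨hθ.1.trans hτ.1.le, hτ.2⟩)
      refine mem_closure_of_tendsto ((s.continuousOn_lam l θ hθ).mono_left h2) ?_
      filter_upwards [Ioo_mem_nhdsGT hθ.2] with τ hτ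
      exact ⟨l, τ, hθ.1.trans hτ.1.le, hτ.2, Or.inr ⟨h.symm, h1.trans_lt hτ.1⟩, rfl⟩
  · rintro _ ⟨l, θ, h1, h2, h3, rfl⟩
    refine ⟨_, l, ?_, rfl⟩
    rw [Finset.mem_compl, mem_below_exp ht ⟨h1, h2⟩]
    rintro (h | ⟨rfl, h⟩)
    · rcases h3 with h3 | ⟨rfl, -⟩
      · exact lt_asymm h h3
      · exact lt_irrefl _ h
    · rcases h3 with h3 | ⟨-, h3⟩
      · exact lt_irrefl _ h3
      · exact lt_asymm h h3

variable {s} in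
-- For an index set closed downwards, the span of its Schur vectors is invariant under triangular
-- matrices; this yields the invariance of `P_ν X`.
theorem Tri.mul_proj {z : Circle} {x : Mat d} (hx : s.Tri z x) {I : Finset (Fin d)}
    (hI : ∀ l ∈ I, ∀ j ≤ l, j ∈ I) : s.proj I z * (x * s.proj I z) = x * s.proj I z := by
  refine s.mc_ext z fun j l => ?_
  rw [mc_proj_mul, mc_mul_proj]
  split_ifs with hj hl
  · rfl
  · rfl
  · exact (hx j l (not_le.1 fun h => hj (hI l ‹_› j h))).symm
  · rfl

end SchurData

end

end BlockConv

/-! ### Assembly of the theorem -/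

open BlockConv in
theorem theorem3p4 (d : ℕ) (p : ℝ≥0∞) [Fact (1 ≤ p)]
    (X : Submodule ℂ (SeqLp d p)) (hX : IsSeqSpace X)
    (A : ℤ → Mat d) (hA : Summable fun n : ℤ => ‖A n‖)
    (s : SchurData (symbol A)) :
    ∃ bA : X →L[ℂ] X, IsConvOp bA A ∧
      -- (i)
      spectrum ℂ bA = ⋃ j : Fin d, closure (Set.range (s.lam j)) ∧
      ((∀ k : Fin d, ∃ D : X →L[ℂ] X, IsConvOp D (fourierCoeffs (s.deltaP k))) →
        ∃ bA0 : X →L[ℂ] X, IsConvOp bA0 (fourierCoeffs s.diag) ∧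
          spectrum ℂ bA = spectrum ℂ bA0) ∧
      -- (ii)
      (∀ (k : Fin d) (t : ℝ), 0 ≤ t → t ≤ 2 * Real.pi →
        ∀ P : X →L[ℂ] X, IsConvOp P (fourierCoeffs (s.projNu k t)) →
          P * P = P ∧
          (∃ h : ∀ x ∈ rangeOf P, bA x ∈ rangeOf P,
            spectrumOn bA (rangeOf P) h = closure (s.preceding k t)) ∧
          spectrumOn ((1 - P) * bA) (rangeOf (1 - P)) (comp_mem_rangeOf (1 - P) bA)
            = closure (s.following k t)) ∧
      -- on the Hilbert space `ℓ_2` all the operators above exist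
      (p = 2 → (∀ k : Fin d, ∃ D : X →L[ℂ] X, IsConvOp D (fourierCoeffs (s.deltaP k))) ∧
        ∀ (k : Fin d) (t : ℝ), 0 ≤ t → t ≤ 2 * Real.pi →
          ∃ P : X →L[ℂ] X, IsConvOp P (fourierCoeffs (s.projNu k t))) := by
  have : Admissible X := hX.admissible
  have ha : ∀ z, MatWiener.eval z (MatWiener.ofCoeffMat A hA) = symbol A z := fun z =>
    (MatWiener.symbol_eq_eval A hA z).symm
  refine ⟨act X (MatWiener.ofCoeffMat A hA), ?_, ?_, ?_, ?_, ?_⟩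
  · have h := isConvOp_act X (MatWiener.ofCoeffMat A hA)
    simpa only [MatWiener.coeffMat_ofCoeffMat] using h
  · rw [spectrum_act_eq s ha, ← closure_iUnion_of_finite]
    congr 1
    ext x
    simp only [Finset.mem_univ, true_and, mem_iUnion, mem_range, mem_ofPred_eq, eq_comm]
    exact exists_comm
  · intro h
    choose D hD using h
    obtain ⟨T, hT, hT'⟩ := exists_diag s ha fun k => ⟨s.bddMeasMat_deltaP k, hD k⟩
    exact ⟨T, hT.isConvOp, hT'⟩
  · intro k t _ ht P hP
    have hPs : HasSymbol P fun z => s.proj (SchurData.below k t z) z :=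
      HasSymbol.congr ⟨s.bddMeasMat_projNu k t, hP⟩ fun z => s.projNu_eq k t z
    have hQs : HasSymbol (1 - P) fun z => s.proj (SchurData.below k t z)ᶜ z :=
      ((HasSymbol.one X).sub hPs).congr fun z => s.one_sub_proj z _
    have hA' := HasSymbol.act X (MatWiener.ofCoeffMat A hA)
    have hPP := HasSymbol.isIdempotent s hPs
    have hPAP : P * (act X (MatWiener.ofCoeffMat A hA) * P) =
        act X (MatWiener.ofCoeffMat A hA) * P := by
      refine (hPs.mul (hA'.mul hPs)).eq (hA'.mul hPs) fun z => ?_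
      rw [ha]
      exact (s.tri_self z).mul_proj fun l hl j hj => SchurData.le_of_mem_below hl hj
    refine ⟨hPP, ⟨?_, ?_⟩, ?_⟩
    · rintro _ ⟨y, rfl⟩
      exact ⟨_, DFunLike.congr_fun hPAP y⟩
    · rw [← s.setOf_below_eq k ht]
      exact spectrumOn_eq s ha hPs (SchurData.ordConnected_below k t)
        (fun τ hτ => SchurData.eventually_below_eq k ht hτ) _ rfl
    · rw [← s.closure_setOf_compl_below_eq k ht]
      refine spectrumOn_eq s ha hQs (SchurData.ordConnected_compl_below k t)
        (fun τ hτ => ?_) _ ?_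
      · filter_upwards [SchurData.eventually_below_eq k ht hτ] with θ hθ
        rw [hθ]
      -- With `Q = 1 - P`, the operator `Q A` has the same compression to `Q X` as `A`.
      · rw [← mul_assoc, HasSymbol.isIdempotent s hQs]
  · exact fun hp => ⟨fun k => (s.bddMeasMat_deltaP k).exists_isConvOp hp,
      fun k t _ _ => (s.bddMeasMat_projNu k t).exists_isConvOp hp⟩
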